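/- Let $\mathsf M$ be a loopless matroid on a finite ground set $E$, with rank function $\operatorname{rk}$ and lattice of flats $\mathcal L(\mathsf M)$ (so $\varnothing$ is its least element and $\vee$ is its join). For $\mathcal G\subseteq\mathcal L(\mathsf M)\setminus\{\varnothing\}$ let $f(\mathcal G)$ denote the set of inclusion-maximal elements of $\mathcal G$, and for a flat $F$ put $$\mathcal G|_F=\{H\in\mathcal G: H\subseteq F\}\subseteq\mathcal L(\mathsf M|_F),\qquad \mathcal G/F=\{H\vee F: H\in\mathcal G,\ H\not\subseteq F\}\subseteq\mathcal L(\mathsf M/F),$$ where $\mathsf M|_F$ and $\mathsf M/F$ are the restriction and the contraction, and a flat $X\supseteq F$ of $\mathsf M$ is identified with the flat $X\setminus F$ of $\mathsf M/F$. The set $\mathcal G$ is a building set if for every flat $F$ the join map $\prod_{H\in f(\mathcal G|_F)}[\varnothing,H]\to[\varnothing,F]$ is an isomorphism of lattices and $\operatorname{rk}(F)=\sum_{H\in f(\mathcal G|_F)}\operatorname{rk}(H)$. The Chow ring of $(\mathsf M,\mathcal G)$ is the graded ring $D(\mathsf M,\mathcal G)=\mathbb Q[x_H: H\in\mathcal G]/I$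 with all $x_H$ in degree $1$, where $I$ is generated by the elements $$\Bigl(\prod_{H\in S}x_H\Bigr)\Bigl(\sum_{H\in\mathcal G,\,H\supseteq K}x_H\Bigr)^{\operatorname{rk}(K)-\operatorname{rk}(\sup(S,K))},\qquad S\subseteq\mathcal G,\ K\in\mathcal G,$$ with $\sup(S,K)=\bigvee_{H\in S,\,H\subsetneq K}H$. Write $\mathrm H_{\mathsf M}^{\mathcal G}(x)=\sum_{i\ge 0}\dim_{\mathbb Q}D^i(\mathsf M,\mathcal G)\,x^i$ for its Hilbert series (which is $1$ if $E=\varnothing$). Theorem. Let $G\in\mathcal G$, and suppose that $\mathcal G$ and $\mathcal G'=\mathcal G\setminus\{G\}$ are both building sets of $\mathcal L(\mathsf M)$. Then $$\mathrm H_{\mathsf M}^{\mathcal G}(x)=\mathrm H_{\mathsf M}^{\mathcal G'}(x)+\bigl(x+x^2+\cdots+x^{|f(\mathcal G'|_G)|-1}\bigr)\cdot\mathrm H_{\mathsf M|_G}^{\mathcal G'|_G}(x)\cdot\mathrm H_{\mathsf M/G}^{\mathcal G'/G}(x).$$ -/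

import Mathlib

open scoped Matroid PowerSeries

noncomputable section

namespace BuildingSet

variable {α : Type*}

/-- The rank of a set in a matroid, as a natural number. (On a matroid with finite ground set
the extended rank `M.eRk X` is always finite.) -/
def rk (M : Matroid α) (X : Set α) : ℕ := (M.eRk X).toNat

/-- `f(𝒢)`: the `𝒢`-factors, i.e. the inclusion-maximal members of `𝒢`. -/
def factors (𝒢 : Set (Set α)) : Set (Set α) := {G | Maximal (fun H => H ∈ 𝒢) G}

/-- `𝒢|_F = {G ∈ 𝒢 : G ⊆ F}`, a family of flats of the restriction `M ↾ F`. -/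
def restr (𝒢 : Set (Set α)) (F : Set α) : Set (Set α) := {G | G ∈ 𝒢 ∧ G ⊆ F}

/-- `𝒢/F = {G ∨ F : G ∈ 𝒢, G ⊈ F}`, as a family of flats of the contraction `M ／ F`. The join of
`G` and `F` in the lattice of flats of `M` is `M.closure (G ∪ F)`; the flat of `M ／ F` (whose ground
set is `M.E \ F`) corresponding to a flat `X ⊇ F` of `M` is `X \ F`. -/
def contr (M : Matroid α) (𝒢 : Set (Set α)) (F : Set α) : Set (Set α) :=
  {X | ∃ G ∈ 𝒢, ¬ G ⊆ F ∧ X = M.closure (G ∪ F) \ F}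

/-- The interval `[∅, F]` in the lattice of flats of `M` (for `M` loopless), ordered by
inclusion. -/
abbrev FlatsBelow (M : Matroid α) (F : Set α) : Type _ := {X : Set α // M.IsFlat X ∧ X ⊆ F}

/-- Building sets on the lattice of flats of a loopless matroid: families `𝒢` of nonempty flats
such that for every flat `F` the join map from the product of the intervals `[∅, G]`, over the
factors `G` of `𝒢_{≤ F}`, to `[∅, F]` is an isomorphism of posets (equivalently, of lattices), and
the rank of `F` is the sum of the ranks of these factors. -/
structure IsBuildingSet (M : Matroid α) (𝒢 : Set (Set α)) : Prop where
  isFlat : ∀ G ∈ 𝒢, M.IsFlat G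
  nonempty : ∀ G ∈ 𝒢, G.Nonempty
  iso : ∀ F, M.IsFlat F →
    ∃ e : ((G : factors (restr 𝒢 F)) → FlatsBelow M (G : Set α)) ≃o FlatsBelow M F,
      ∀ X, (e X : Set α) = M.closure (⋃ G, (X G : Set α))
  rk_eq : ∀ F, M.IsFlat F → rk M F = ∑ᶠ G ∈ factors (restr 𝒢 F), rk M G

/-- `sup(S, G)`: the join, in the lattice of flats, of the members of `S` strictly below `G`. -/
def supBelow (M : Matroid α) {𝒢 : Set (Set α)} (S : Finset 𝒢) (G : 𝒢) : Set α :=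
  M.closure (⋃ H ∈ {H : 𝒢 | H ∈ S ∧ (H : Set α) ⊂ (G : Set α)}, (H : Set α))

/-- The linear form `∑_{H ∈ 𝒢, H ≥ G} x_H`. (The sum is finite when `𝒢` is a family of flats of a
matroid with finite ground set.) -/
def upSum {𝒢 : Set (Set α)} (G : 𝒢) : MvPolynomial 𝒢 ℚ :=
  ∑ᶠ H ∈ {H : 𝒢 | (G : Set α) ⊆ (H : Set α)}, MvPolynomial.X H

/-- The defining ideal of the Chow ring: it is generated by
`(∏_{H ∈ S} x_H) * (∑_{H ≥ G} x_H) ^ (rk G - rk sup(S, G))` for all `S ⊆ 𝒢` and `G ∈ 𝒢`.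
(For flats the exponent is a genuine difference, since `sup(S, G) ⊆ G`.) -/
def chowIdeal (M : Matroid α) (𝒢 : Set (Set α)) : Ideal (MvPolynomial 𝒢 ℚ) :=
  Ideal.span {p | ∃ (S : Finset 𝒢) (G : 𝒢),
    p = (∏ H ∈ S, MvPolynomial.X H) * upSum G ^ (rk M G - rk M (supBelow M S G))}

/-- The Chow ring `D(M, 𝒢)`. -/
abbrev ChowRing (M : Matroid α) (𝒢 : Set (Set α)) : Type _ :=
  MvPolynomial 𝒢 ℚ ⧸ chowIdeal M 𝒢

/-- The graded piece `D^i(M, 𝒢)`: the classes of homogeneous polynomials of degree `i`. -/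
def chowPiece (M : Matroid α) (𝒢 : Set (Set α)) (i : ℕ) : Submodule ℚ (ChowRing M 𝒢) :=
  (MvPolynomial.homogeneousSubmodule 𝒢 ℚ i).map (Ideal.Quotient.mkₐ ℚ (chowIdeal M 𝒢)).toLinearMap

/-- The Hilbert series `∑_i dim D^i(M, 𝒢) x^i` of the Chow ring. For the matroid on the empty
ground set (and `𝒢 = ∅`) the Chow ring is `ℚ` and the series is `1`. -/
def hilb (M : Matroid α) (𝒢 : Set (Set α)) : ℤ⟦X⟧ :=
  PowerSeries.mk fun i => (Module.finrank ℚ (chowPiece M 𝒢 i) : ℤ)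

end BuildingSet

end

/-! Adding `G` to `𝒢'` behaves like a blow-up. Put `A = D(M, 𝒢')`, `B = D(M, 𝒢)`, `t = x_G`, and let
the Chow ring of the center be `C = D(M|G, 𝒢'|G) ⊗ D(M/G, 𝒢'/G)`. The pullback `A → B` sends `x_L`
to `x_L + t` when `L` is a factor of `G` and fixes the other variables; a surjection `ψ : A → C` is
restriction to the center. Let `P = ∏ (X - x_L)` over the `k` factors, monic of degree `k`. Then `B
= A[X]/(P, X · ker ψ)`, and `P(0)` kills `ker ψ`, so division by `P` gives a graded decomposition `B
= A ⊕ tC ⊕ ... ⊕ t^(k-1) C`. Its Hilbert series is the formula.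

Rings are compared through families of elements satisfying the relations (`IsChow`), which are the
same as homomorphisms out of the Chow ring. An element is exceptional (`IsExc`) if it satisfies,
with such a family, the relations that involve `x_G` as a factor. Examples are `x_G` in `B`, the
class of `X` in the quotient of `A[X]`, the product of the `x_L` in `A`, and `1` in `C`.

Two facts carry the proof. An exceptional `t` kills `ker ψ` (`mul_eq_zero_of_toCenterHom_eq_zero`):
modulo the annihilator of `t` the element `1` is exceptional, and such a family factors through `C`.
Conversely, subtracting an exceptional `T` from the factor variables gives the relations for `𝒢`,
provided `∏ (x_L - T) = 0` (`isChow_strict`); the hard case is the relation at `G` itself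
(`strict_rel_center`). The latter identifies the kernel of `A[X] → B` (`exists_of_eval₂_eq_zero`),
and `blowUpMap_injective` and `blowUpMap_surjective` finish. -/

open scoped Matroid PowerSeries

noncomputable section

namespace BuildingSet

section

variable {α : Type*}

/-! ### Natural-number rank on a finite matroid. -/

section Rank

variable {M : Matroid α}

lemma coe_rk [M.Finite] (X : Set α) : (rk M X : ℕ∞) = M.eRk X :=
  ENat.natCast_toNat (Matroid.eRk_ne_top_iff.2 (M.isRkFinite_set X))

lemma rk_mono [M.Finite] {X Y : Set α} (h : X ⊆ Y) : rk M X ≤ rk M Y := by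
  have := M.eRk_mono h
  rw [← coe_rk, ← coe_rk] at this
  exact_mod_cast this

lemma rk_submod [M.Finite] (X Y : Set α) : rk M (X ∩ Y) + rk M (X ∪ Y) ≤ rk M X + rk M Y := by
  have := M.eRk_inter_add_eRk_union_le X Y
  simp only [← coe_rk] at this
  exact_mod_cast this

lemma rk_union_le [M.Finite] (X Y : Set α) : rk M (X ∪ Y) ≤ rk M X + rk M Y :=
  le_add_self.trans (rk_submod X Y)

@[simp] lemma rk_empty : rk M ∅ = 0 := by simp [rk]

@[simp] lemma rk_closure (X : Set α) : rk M (M.closure X) = rk M X := by simp [rk]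

lemma rk_restrict {R X : Set α} (h : X ⊆ R) : rk (M ↾ R) X = rk M X := by
  simp [rk, M.restrict_eRk_eq h]

/-- A basis of `C` extends to one of `X ∪ C`, and the added elements count the rank of `X` in the
contraction. -/
lemma rk_contract [M.Finite] (X C : Set α) :
    rk (M ／ C) X + rk M C = rk M (X ∪ C) := by
  obtain ⟨J, hJ⟩ := M.exists_isBasis' C
  obtain ⟨I, hI, hJI⟩ := hJ.indep.subset_isBasis'_of_subset (hJ.subset.trans
    (Set.subset_union_right (s := X)))
  have hIC : I ∩ C = J := by
    refine (hJ.eq_of_subset_indep (hI.indep.inter_right C) (Set.subset_inter hJI hJ.subset)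
      Set.inter_subset_right).symm
  have hIJ : I \ C ∪ J = I := by rw [← hIC, Set.sdiff_union_inter]
  have h1 := hI.contract_isBasis' hJ (by rw [hIJ]; exact hI.indep)
  have h2 : (M ／ C).eRk X = (I \ C).encard := by
    rw [h1.encard_eq_eRk, ← (M ／ C).eRk_inter_ground X, ← (M ／ C).eRk_inter_ground (_ \ _)]
    congr 1
    ext e; simp; tauto
  have h3 : (I \ C).encard + J.encard = I.encard := by
    rw [← hIC]; exact Set.encard_sdiff_add_encard_inter I C
  have : (rk (M ／ C) X : ℕ∞) + rk M C = rk M (X ∪ C) := by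
    rw [coe_rk, coe_rk, coe_rk, h2, ← hJ.encard_eq_eRk, ← hI.encard_eq_eRk, h3]
  exact_mod_cast this

lemma eq_empty_of_rk_eq_zero [M.Finite] [M.Loopless] {X : Set α} (hX : X ⊆ M.E)
    (h : rk M X = 0) : X = ∅ := by
  have h0 : M.eRk X = 0 := by rw [← coe_rk, h]; rfl
  rw [Matroid.eRk_eq_zero_iff hX, M.loops_eq_empty] at h0
  exact Set.subset_empty_iff.1 h0

lemma eq_of_subset_of_rk_le [M.Finite] {X Y : Set α} (hX : M.IsFlat X)
    (hY : Y ⊆ M.E) (h : X ⊆ Y) (hr : rk M Y ≤ rk M X) : X = Y := by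
  have h1 : M.eRk Y ≤ M.eRk X := by
    rw [← coe_rk, ← coe_rk]; exact_mod_cast hr
  have := (M.isRkFinite_set X).closure_eq_closure_of_subset_of_eRk_ge_eRk h h1
  rw [hX.closure] at this
  exact h.antisymm (this ▸ M.subset_closure Y hY)

lemma rk_sUnion_le [M.Finite] {s : Set (Set α)} (hs : s.Finite) :
    rk M (⋃₀ s) ≤ ∑ᶠ H ∈ s, rk M H := by
  induction s, hs using Set.Finite.induction_on with
  | empty => simp
  | @insert a s ha hs ih =>
    rw [Set.sUnion_insert, finsum_mem_insert _ ha hs]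
    exact (rk_union_le _ _).trans (by gcongr)

/-- If two sets are skew, then so are their subsets. -/
lemma rk_union_eq_of_subset [M.Finite] {X Y Z : Set α} (h : rk M (X ∪ Y) = rk M X + rk M Y)
    (hZ : Z ⊆ X) : rk M (Z ∪ Y) = rk M Z + rk M Y := by
  have h1 := rk_submod (M := M) (Z ∪ Y) X
  have h2 : Z ∪ Y ∪ X = X ∪ Y := by grind
  rw [h2] at h1
  have h3 : rk M Z ≤ rk M ((Z ∪ Y) ∩ X) := rk_mono (by grind)
  have := rk_union_le (M := M) Z Y
  omega

end Rank

/-! ### Factors of flats in a building set. -/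

section Building

variable {M : Matroid α} [M.Finite] {𝒢 : Set (Set α)}

lemma IsBuildingSet.finite (hB : IsBuildingSet M 𝒢) : 𝒢.Finite :=
  M.ground_finite.finite_subsets.subset fun H hH => (hB.isFlat H hH).subset_ground

lemma restr_subset (𝒢 : Set (Set α)) (F : Set α) : restr 𝒢 F ⊆ 𝒢 := fun _ h => h.1

lemma factors_restr_subset (𝒢 : Set (Set α)) (F : Set α) : factors (restr 𝒢 F) ⊆ 𝒢 :=
  fun _ h => h.prop.1

lemma IsBuildingSet.exists_le_factor (hB : IsBuildingSet M 𝒢) {F H : Set α}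
    (hH : H ∈ 𝒢) (hHF : H ⊆ F) : ∃ K ∈ factors (restr 𝒢 F), H ⊆ K := by
  obtain ⟨K, hHK, hK⟩ := (hB.finite.subset (restr_subset 𝒢 F)).exists_le_maximal
    (show H ∈ restr 𝒢 F from ⟨hH, hHF⟩)
  exact ⟨K, hK, hHK⟩

variable [M.Loopless]

/-- The isomorphism writes the closure of `e` as a join of flats below the factors. One of them has
a point, as there are no loops; that point is parallel to `e`, so the flat contains `e`. Thus a flat
is the plain union of its factors, not merely their join. -/
lemma IsBuildingSet.exists_mem_factor (hB : IsBuildingSet M 𝒢) {F : Set α} (hF : M.IsFlat F)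
    {e : α} (he : e ∈ F) : ∃ K ∈ factors (restr 𝒢 F), e ∈ K := by
  obtain ⟨i, hi⟩ := hB.iso F hF
  have heE : e ∈ M.E := hF.subset_ground he
  let c : FlatsBelow M F := ⟨M.closure {e}, M.isFlat_closure _,
    hF.closure ▸ M.closure_subset_closure (Set.singleton_subset_iff.2 he)⟩
  have h1 := hi (i.symm c)
  rw [i.apply_symm_apply] at h1
  change M.closure {e} = _ at h1
  have h2 : e ∈ M.closure {e} := M.mem_closure_self e heE
  rcases Set.eq_empty_or_nonempty (⋃ G, (i.symm c G : Set α)) with h0 | ⟨f, hf⟩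
  · rw [h1, h0, M.closure_empty, M.loops_eq_empty] at h2
    exact h2.elim
  · have hfE : f ∈ M.E := by
      obtain ⟨K, hK⟩ := Set.mem_iUnion.1 hf
      exact (i.symm c K).2.1.subset_ground hK
    have hfe : f ∈ M.closure {e} := by
      rw [h1]
      refine M.subset_closure _ ?_ hf
      exact Set.iUnion_subset fun K => (i.symm c K).2.1.subset_ground
    obtain ⟨K, hK⟩ := Set.mem_iUnion.1 hf
    refine ⟨K, K.2, (i.symm c K).2.2 ?_⟩
    have h3 : M.closure {f} = M.closure {e} := by
      refine eq_of_subset_of_rk_le (M.isFlat_closure _) (M.closure_subset_ground _) ?_ ?_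
      · exact M.closure_subset_closure_of_subset_closure (Set.singleton_subset_iff.2 hfe)
      · simp [rk, M.eRk_singleton_eq heE, M.eRk_singleton_eq hfE]
    rw [← (i.symm c K).2.1.closure]
    exact M.closure_subset_closure (Set.singleton_subset_iff.2 hK) (h3 ▸ h2)

/-- Rank is subadditive over the factors, yet their ranks add up to that of `F`. This forces
skewness, and an intersection of rank zero is empty without loops. -/
lemma IsBuildingSet.factor_skew (hB : IsBuildingSet M 𝒢) {F H : Set α} (hF : M.IsFlat F)
    (hH : H ∈ factors (restr 𝒢 F)) :
    H ∩ ⋃₀ (factors (restr 𝒢 F) \ {H}) = ∅ ∧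
      rk M (H ∪ ⋃₀ (factors (restr 𝒢 F) \ {H})) =
        rk M H + rk M (⋃₀ (factors (restr 𝒢 F) \ {H})) ∧
      F = H ∪ ⋃₀ (factors (restr 𝒢 F) \ {H}) := by
  set Γ := factors (restr 𝒢 F) with hΓ
  have hfin : Γ.Finite := hB.finite.subset (factors_restr_subset 𝒢 F)
  have hFu : F = H ∪ ⋃₀ (Γ \ {H}) := by
    rw [← Set.sUnion_insert, Set.insert_sdiff_singleton, Set.insert_eq_of_mem hH]
    refine subset_antisymm (fun e he => ?_) (Set.sUnion_subset fun K hK => hK.prop.2)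
    obtain ⟨K, hK, heK⟩ := hB.exists_mem_factor hF he
    exact ⟨K, hK, heK⟩
  have h1 := hB.rk_eq F hF
  rw [← hΓ] at h1
  have h2 : ∑ᶠ K ∈ Γ, rk M K = rk M H + ∑ᶠ K ∈ Γ \ {H}, rk M K := by
    rw [← finsum_mem_insert _ (by simp) (hfin.subset Set.sdiff_subset),
      Set.insert_sdiff_singleton, Set.insert_eq_of_mem hH]
  have h3 := rk_sUnion_le (M := M) (hfin.subset (Set.sdiff_subset (t := {H})))
  have h4 := rk_submod (M := M) H (⋃₀ (Γ \ {H}))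
  have h5 : rk M F = rk M (H ∪ ⋃₀ (Γ \ {H})) := by rw [← hFu]
  refine ⟨?_, by omega, hFu⟩
  refine eq_empty_of_rk_eq_zero (M := M) ?_ (by omega)
  exact (Set.inter_subset_left).trans (hB.isFlat H (factors_restr_subset _ _ hH)).subset_ground

lemma IsBuildingSet.factors_disjoint (hB : IsBuildingSet M 𝒢) {F H K : Set α} (hF : M.IsFlat F)
    (hH : H ∈ factors (restr 𝒢 F)) (hK : K ∈ factors (restr 𝒢 F)) (hHK : (H ∩ K).Nonempty) :
    H = K := by
  by_contra hne
  obtain ⟨e, he, he'⟩ := hHK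
  exact Set.notMem_empty e ((hB.factor_skew hF hH).1 ▸ ⟨he, K, ⟨hK, Ne.symm hne⟩, he'⟩)

lemma IsBuildingSet.rk_union_factor (hB : IsBuildingSet M 𝒢) {F H X : Set α} (hF : M.IsFlat F)
    (hH : H ∈ factors (restr 𝒢 F)) (hX : X ⊆ F) (hd : X ∩ H = ∅) :
    rk M (X ∪ H) = rk M X + rk M H := by
  obtain ⟨-, h2, h3⟩ := hB.factor_skew hF hH
  refine rk_union_eq_of_subset (X := ⋃₀ (factors (restr 𝒢 F) \ {H})) ?_ ?_
  · rw [Set.union_comm, h2, add_comm]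
  · rw [h3] at hX
    intro e he
    exact (hX he).resolve_left fun h => Set.notMem_empty e (hd ▸ ⟨he, h⟩)

/-- The factors of the join that contain `H` and `G` share a point, so they coincide, and this one
factor must be the whole join. -/
lemma IsBuildingSet.closure_union_mem (hB : IsBuildingSet M 𝒢) {G H : Set α} (hG : G ∈ 𝒢)
    (hH : H ∈ 𝒢) (h : (H ∩ G).Nonempty) : M.closure (H ∪ G) ∈ 𝒢 := by
  have hs : H ∪ G ⊆ M.E :=
    Set.union_subset (hB.isFlat H hH).subset_ground (hB.isFlat G hG).subset_ground
  have hs' := M.subset_closure _ hs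
  have hF := M.isFlat_closure (H ∪ G)
  obtain ⟨K, hK, hGK⟩ := hB.exists_le_factor hG (Set.subset_union_right.trans hs')
  obtain ⟨L, hL, hHL⟩ := hB.exists_le_factor hH (Set.subset_union_left.trans hs')
  obtain rfl := hB.factors_disjoint hF hL hK (h.mono (Set.inter_subset_inter hHL hGK))
  have : M.closure (H ∪ G) = L := by
    refine subset_antisymm ?_ hL.prop.2
    rw [← (hB.isFlat L hL.prop.1).closure]
    exact M.closure_subset_closure (Set.union_subset hHL hGK)
  exact this ▸ hL.prop.1

/-- Two members of a building set whose join does not belong to it are the factors of the join. -/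
lemma IsBuildingSet.of_closure_union_notMem (hB : IsBuildingSet M 𝒢) {G H : Set α} (hG : G ∈ 𝒢)
    (hH : H ∈ 𝒢) (h : M.closure (H ∪ G) ∉ 𝒢) :
    H ∩ G = ∅ ∧ M.closure (H ∪ G) = H ∪ G ∧ rk M (H ∪ G) = rk M H + rk M G ∧
      ∀ K ∈ 𝒢, K ⊆ H ∪ G → K ⊆ H ∨ K ⊆ G := by
  have hs : H ∪ G ⊆ M.E :=
    Set.union_subset (hB.isFlat H hH).subset_ground (hB.isFlat G hG).subset_ground
  have hs' := M.subset_closure _ hs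
  have hF := M.isFlat_closure (H ∪ G)
  obtain ⟨G₁, hG₁, hGG₁⟩ := hB.exists_le_factor hG (Set.subset_union_right.trans hs')
  obtain ⟨H₁, hH₁, hHH₁⟩ := hB.exists_le_factor hH (Set.subset_union_left.trans hs')
  have hne : H₁ ≠ G₁ := by
    rintro rfl
    have : M.closure (H ∪ G) = H₁ := by
      refine subset_antisymm ?_ hH₁.prop.2
      rw [← (hB.isFlat _ hH₁.prop.1).closure]
      exact M.closure_subset_closure (Set.union_subset hHH₁ hGG₁)
    exact h (this ▸ hH₁.prop.1)
  obtain ⟨h1, h2, h3⟩ := hB.factor_skew hF hG₁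
  set O := ⋃₀ (factors (restr 𝒢 (M.closure (H ∪ G))) \ {G₁}) with hO
  have hH₁O : H₁ ⊆ O := Set.subset_sUnion_of_mem ⟨hH₁, hne⟩
  have hOE : O ⊆ M.E := (Set.subset_union_right.trans h3.superset).trans hF.subset_ground
  rw [← h3, rk_closure] at h2
  have h4 := rk_union_le (M := M) H G
  have h5 : rk M G ≤ rk M G₁ := rk_mono hGG₁
  have h6 : rk M H ≤ rk M O := rk_mono (hHH₁.trans hH₁O)
  -- `rk (H ∪ G) ≤ rk H + rk G ≤ rk O + rk G₁ = rk (H ∪ G)` forces equality in each term.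
  have hGeq : G = G₁ := eq_of_subset_of_rk_le (hB.isFlat G hG)
    (hB.isFlat _ hG₁.prop.1).subset_ground hGG₁ (by omega)
  have hHeq : H = O := eq_of_subset_of_rk_le (hB.isFlat H hH) hOE (hHH₁.trans hH₁O) (by omega)
  refine ⟨?_, ?_, by omega, fun K hK hKs => ?_⟩
  · rw [hHeq, hGeq, Set.inter_comm, h1]
  · rw [h3, ← hHeq, ← hGeq, Set.union_comm]
  · obtain ⟨K₁, hK₁, hKK₁⟩ := hB.exists_le_factor hK (hKs.trans hs')
    by_cases hKG : K₁ = G₁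
    · exact Or.inr (hGeq ▸ hKG ▸ hKK₁)
    · refine Or.inl (hKK₁.trans ?_)
      rw [hHeq]
      exact Set.subset_sUnion_of_mem ⟨hK₁, hKG⟩

end Building

end

/-! ### The center of the blow-up and its link. -/

section

variable {α : Type*}

/-- The combinatorial relation between a flat `G` and a building set not containing it that makes
adding `G` to the building set a blow-up. -/
structure IsCenter (M : Matroid α) (𝒢 : Set (Set α)) (G : Set α) : Prop where
  finite : 𝒢.Finite
  isFlat : ∀ H ∈ 𝒢, M.IsFlat H
  nonempty : ∀ H ∈ 𝒢, H.Nonempty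
  isFlat_center : M.IsFlat G
  notMem : G ∉ 𝒢
  closure_mem : ∀ H ∈ 𝒢, ∀ K ∈ 𝒢, (H ∩ K).Nonempty → M.closure (H ∪ K) ∈ 𝒢
  sUnion_factors : ⋃₀ factors (restr 𝒢 G) = G
  exists_le : ∀ H ∈ 𝒢, H ⊆ G → ∃ L ∈ factors (restr 𝒢 G), H ⊆ L
  disjoint : ∀ L ∈ factors (restr 𝒢 G), ∀ L' ∈ factors (restr 𝒢 G), (L ∩ L').Nonempty → L = L'
  skew : ∀ L ∈ factors (restr 𝒢 G), ∀ X ⊆ G, X ∩ L = ∅ → rk M (X ∪ L) = rk M X + rk M L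
  closure_center_mem : ∀ H ∈ 𝒢, ¬ H ⊆ G → (H ∩ G).Nonempty → M.closure (H ∪ G) ∈ 𝒢
  transversal : ∀ H ∈ 𝒢, ¬ H ⊆ G → M.closure (H ∪ G) ∉ 𝒢 →
    M.closure (H ∪ G) = H ∪ G ∧ rk M (H ∪ G) = rk M H + rk M G ∧
      ∀ K ∈ 𝒢, K ⊆ H ∪ G → K ⊆ H ∨ K ⊆ G

/-- The two building-set hypotheses enter the rest of the argument only through these consequences
and the nonemptiness of `G`. -/
lemma IsBuildingSet.isCenter {M : Matroid α} [M.Finite] [M.Loopless]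
    {𝒢 𝒢' : Set (Set α)} {G : Set α} (hG : G ∈ 𝒢) (h𝒢' : 𝒢' = 𝒢 \ {G})
    (hB : IsBuildingSet M 𝒢) (hB' : IsBuildingSet M 𝒢') : IsCenter M 𝒢' G := by
  have hGf := hB.isFlat G hG
  have hsub : 𝒢' ⊆ 𝒢 := h𝒢' ▸ Set.sdiff_subset
  have hmem : ∀ {H}, H ∈ 𝒢 → ¬ H ⊆ G → H ∈ 𝒢' := fun hH hHG => by
    rw [h𝒢']; exact ⟨hH, fun h => hHG h.subset⟩
  have hle : ∀ {H}, H ∈ 𝒢 → H ⊆ M.closure (H ∪ G) := fun hH =>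
    Set.subset_union_left.trans (M.subset_closure _
      (Set.union_subset (hB.isFlat _ hH).subset_ground hGf.subset_ground))
  refine
    { finite := hB'.finite
      isFlat := hB'.isFlat
      nonempty := hB'.nonempty
      isFlat_center := hGf
      notMem := by simp [h𝒢']
      closure_mem := fun H hH K hK h => hB'.closure_union_mem hK hH h
      sUnion_factors := ?_
      exists_le := fun H hH h => hB'.exists_le_factor hH h
      disjoint := fun L hL L' hL' h => hB'.factors_disjoint hGf hL hL' h
      skew := fun L hL X hX h => hB'.rk_union_factor hGf hL hX h
      closure_center_mem := fun H hH hHG h => hmem (hB.closure_union_mem hG (hsub hH) h)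
        fun h' => hHG ((hle (hsub hH)).trans h')
      transversal := fun H hH hHG h => ?_ }
  · refine subset_antisymm (Set.sUnion_subset fun K hK => hK.prop.2) fun e he => ?_
    obtain ⟨K, hK, heK⟩ := hB'.exists_mem_factor hGf he
    exact ⟨K, hK, heK⟩
  · obtain ⟨-, h2, h3, h4⟩ := hB.of_closure_union_notMem hG (hsub hH)
      fun h' => h (hmem h' fun h'' => hHG ((hle (hsub hH)).trans h''))
    exact ⟨h2, h3, fun K hK => h4 K (hsub hK)⟩

/-- The members of `𝒢` not below `G` that form a nested set with `G` in `𝒢 ∪ {G}`. -/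
def link (M : Matroid α) (𝒢 : Set (Set α)) (G : Set α) : Set (Set α) :=
  {H | H ∈ 𝒢 ∧ ¬ H ⊆ G ∧ (G ⊆ H ∨ M.closure (H ∪ G) ∉ 𝒢)}

namespace IsCenter

variable {M : Matroid α} {𝒢 : Set (Set α)} {G : Set α}

lemma subset_join (h : IsCenter M 𝒢 G) {H : Set α} (hH : H ∈ 𝒢) :
    H ∪ G ⊆ M.closure (H ∪ G) :=
  M.subset_closure _ (Set.union_subset (h.isFlat _ hH).subset_ground h.isFlat_center.subset_ground)

lemma join_eq_self (h : IsCenter M 𝒢 G) {H : Set α} (hH : H ∈ 𝒢) (hGH : G ⊆ H) :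
    M.closure (H ∪ G) = H := by
  rw [Set.union_eq_left.2 hGH, (h.isFlat H hH).closure]

lemma join_subset (h : IsCenter M 𝒢 G) {H K : Set α} (hK : K ∈ 𝒢) (hGK : G ⊆ K) (hH : H ⊆ K) :
    M.closure (H ∪ G) ⊆ K := by
  rw [← (h.isFlat K hK).closure]
  exact M.closure_subset_closure (Set.union_subset hH hGK)

lemma center_ssubset_join (h : IsCenter M 𝒢 G) {H : Set α} (hH : H ∈ 𝒢) (hHG : ¬ H ⊆ G) :
    G ⊂ M.closure (H ∪ G) :=
  ⟨Set.subset_union_right.trans (h.subset_join hH),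
    fun h' => hHG (Set.subset_union_left.trans ((h.subset_join hH).trans h'))⟩

lemma factor_mem {L : Set α} (hL : L ∈ factors (restr 𝒢 G)) : L ∈ 𝒢 := hL.prop.1

lemma factor_subset {L : Set α} (hL : L ∈ factors (restr 𝒢 G)) : L ⊆ G := hL.prop.2

lemma not_factor_ssubset {L K : Set α} (hL : L ∈ factors (restr 𝒢 G)) (hK : K ∈ 𝒢)
    (hLK : L ⊂ K) : ¬ K ⊆ G :=
  fun hKG => hLK.2 (hL.le_of_ge ⟨hK, hKG⟩ hLK.1)

lemma factor_ssubset (h : IsCenter M 𝒢 G) {L : Set α} (hL : L ∈ factors (restr 𝒢 G)) : L ⊂ G :=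
  (factor_subset hL).ssubset_of_ne fun h' => h.notMem (h' ▸ factor_mem hL)

lemma factor_eq_of_subset (h : IsCenter M 𝒢 G) {H L L' : Set α} (hH : H ∈ 𝒢)
    (hL : L ∈ factors (restr 𝒢 G)) (hL' : L' ∈ factors (restr 𝒢 G)) (h1 : H ⊆ L) (h2 : H ⊆ L') :
    L = L' :=
  h.disjoint L hL L' hL' ((h.nonempty H hH).mono (Set.subset_inter h1 h2))

lemma finite_factors (h : IsCenter M 𝒢 G) : (factors (restr 𝒢 G)).Finite :=
  h.finite.subset (factors_restr_subset 𝒢 G)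

lemma join_of_link (h : IsCenter M 𝒢 G) {H : Set α} (hH : H ∈ link M 𝒢 G) :
    M.closure (H ∪ G) = H ∪ G := by
  obtain ⟨h1, h2, h3 | h3⟩ := hH
  · rw [h.join_eq_self h1 h3, Set.union_eq_left.2 h3]
  · exact (h.transversal H h1 h2 h3).1

lemma join_mem_of_notMem_link {H : Set α} (hH : H ∈ 𝒢) (hHG : ¬ H ⊆ G)
    (hl : H ∉ link M 𝒢 G) : M.closure (H ∪ G) ∈ 𝒢 ∧ ¬ G ⊆ H := by
  by_contra hc
  exact hl ⟨hH, hHG, by tauto⟩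

lemma mem_link_of_subset (h : IsCenter M 𝒢 G) {H : Set α} (hH : H ∈ 𝒢) (hGH : G ⊆ H) :
    H ∈ link M 𝒢 G :=
  ⟨hH, fun h' => h.notMem (hGH.antisymm h' ▸ hH), Or.inl hGH⟩

/-- The join of a linked `H` with `G` is the plain union. If `H` does not contain `G`,
transversality puts each member below the union on one side of it, so inclusion in `H` can be tested
after removing `G`. -/
lemma subset_iff_of_link (h : IsCenter M 𝒢 G) {H K : Set α} (hK : K ∈ 𝒢) (hKG : ¬ K ⊆ G)
    (hH : H ∈ link M 𝒢 G) : K ⊆ H ↔ M.closure (K ∪ G) \ G ⊆ H \ G := by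
  constructor
  · intro hKH e he
    have : M.closure (K ∪ G) ⊆ H ∪ G := by
      rw [← h.join_of_link hH]
      exact M.closure_subset_closure (Set.union_subset_union_left G hKH)
    exact ⟨(this he.1).resolve_right he.2, he.2⟩
  · intro hs
    have hKs : K ⊆ H ∪ G := fun e he => by
      by_cases heG : e ∈ G
      · exact Or.inr heG
      · exact Or.inl (hs ⟨h.subset_join hK (Or.inl he), heG⟩).1
    obtain ⟨h1, h2, h3 | h3⟩ := hH
    · rwa [Set.union_eq_left.2 h3] at hKs
    · exact ((h.transversal H h1 h2 h3).2.2 K hK hKs).resolve_right hKG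

lemma join_sdiff_of_link (h : IsCenter M 𝒢 G) {H : Set α} (hH : H ∈ link M 𝒢 G) :
    M.closure (H ∪ G) \ G = H \ G := by
  rw [h.join_of_link hH, Set.union_sdiff_right]

lemma injOn_link (h : IsCenter M 𝒢 G) : Set.InjOn (· \ G) (link M 𝒢 G) := by
  intro H hH K hK hHK
  refine subset_antisymm ?_ ?_
  · rw [h.subset_iff_of_link hH.1 hH.2.1 hK, h.join_sdiff_of_link hH]
    exact hHK.subset
  · rw [h.subset_iff_of_link hK.1 hK.2.1 hH, h.join_sdiff_of_link hK]
    exact hHK.superset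

lemma join_sdiff_mem (_h : IsCenter M 𝒢 G) {H : Set α} (hH : H ∈ 𝒢) (hHG : ¬ H ⊆ G) :
    M.closure (H ∪ G) \ G ∈ contr M 𝒢 G := ⟨H, hH, hHG, rfl⟩

/-- If the join of `H` with `G` is a member, it is linked and represents `H`; otherwise `H` itself
is linked. With `injOn_link`, the link indexes the variables of the contraction. -/
lemma contr_eq (h : IsCenter M 𝒢 G) : contr M 𝒢 G = (· \ G) '' link M 𝒢 G := by
  ext X
  constructor
  · rintro ⟨H, hH, hHG, rfl⟩
    by_cases hJ : M.closure (H ∪ G) ∈ 𝒢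
    · exact ⟨_, h.mem_link_of_subset hJ (h.center_ssubset_join hH hHG).1, rfl⟩
    · have hl : H ∈ link M 𝒢 G := ⟨hH, hHG, Or.inr hJ⟩
      exact ⟨H, hl, (h.join_sdiff_of_link hl).symm⟩
  · rintro ⟨H, hH, rfl⟩
    exact ⟨H, hH.1, hH.2.1, (h.join_sdiff_of_link hH).symm⟩

lemma subset_of_meets_of_link (h : IsCenter M 𝒢 G) {H : Set α} (hH : H ∈ link M 𝒢 G)
    (hHG : (H ∩ G).Nonempty) : G ⊆ H := by
  obtain ⟨h1, h2, h3 | h3⟩ := hH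
  · exact h3
  · exact (h3 (h.closure_center_mem H h1 h2 hHG)).elim

lemma notMem_link_of_meets (h : IsCenter M 𝒢 G) {H : Set α} (hGH : ¬ G ⊆ H)
    (hHG : (H ∩ G).Nonempty) : H ∉ link M 𝒢 G :=
  fun hl => hGH (h.subset_of_meets_of_link hl hHG)

/-- If the join of `K` with the center belongs to `𝒢`, then a linked set above `K` contains the
center. -/
lemma center_subset_of_link (h : IsCenter M 𝒢 G) {H K : Set α} (hK : K ∈ 𝒢) (hKG : ¬ K ⊆ G)
    (hJ : M.closure (K ∪ G) ∈ 𝒢) (hH : H ∈ link M 𝒢 G) (hKH : K ⊆ H) : G ⊆ H := by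
  have h1 : M.closure (K ∪ G) ⊆ M.closure (H ∪ G) :=
    M.closure_subset_closure (Set.union_subset_union_left G hKH)
  have h2 := h.join_of_link hH
  obtain ⟨h3, h4, h5 | h5⟩ := hH
  · exact h5
  · rcases (h.transversal H h3 h4 h5).2.2 _ hJ (h2 ▸ h1) with h6 | h6
    · exact (h.center_ssubset_join hK hKG).1.trans h6
    · exact ((h.center_ssubset_join hK hKG).2 h6).elim

/-- Submodularity. Joining with `G` only lowers rank differences, so a relation with contracted
exponents implies the one with the original exponents. -/
lemma rk_join_sub_le [M.Finite] {K X : Set α} (hX : X ⊆ K) :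
    rk M (K ∪ G) - rk M (X ∪ G) ≤ rk M K - rk M X := by
  have h1 := rk_submod (M := M) K (X ∪ G)
  have h2 : K ∪ (X ∪ G) = K ∪ G := by rw [← Set.union_assoc, Set.union_eq_left.2 hX]
  have h3 : rk M X ≤ rk M (K ∩ (X ∪ G)) :=
    rk_mono (Set.subset_inter hX Set.subset_union_left)
  have h4 : rk M X ≤ rk M K := rk_mono hX
  rw [h2] at h1
  omega

end IsCenter

end

/-! ### Families satisfying the Chow and the exceptional relations. -/

section

variable {α : Type*}

section

variable {R : Type*} [CommRing R]

lemma mul_pow_eq_zero_of_le {a y : R} {m n : ℕ} (h : a * y ^ m = 0) (hmn : m ≤ n) :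
    a * y ^ n = 0 := by
  obtain ⟨k, rfl⟩ := Nat.exists_eq_add_of_le hmn
  rw [pow_add, ← mul_assoc, h, zero_mul]

lemma mul_pow_congr {t a b : R} (h : t * a = t * b) (n : ℕ) : t * a ^ n = t * b ^ n := by
  induction n with
  | zero => simp
  | succ n ih => rw [pow_succ, ← mul_assoc, ih, mul_right_comm, h, pow_succ]; ring

lemma dvd_prod_sub_prod {ι : Type*} {t : R} {f g : ι → R} {S : Finset ι}
    (h : ∀ i ∈ S, t ∣ f i - g i) : t ∣ ∏ i ∈ S, f i - ∏ i ∈ S, g i := by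
  simp_rw [← Ideal.mem_span_singleton, ← Ideal.Quotient.eq] at h ⊢
  rw [map_prod, map_prod]
  exact Finset.prod_congr rfl h

/-- The sum of the `x H` over the members `H` of `𝒢` above `K`. -/
def ups (𝒢 : Set (Set α)) (x : Set α → R) (K : Set α) : R := ∑ᶠ H ∈ {H | H ∈ 𝒢 ∧ K ⊆ H}, x H

open scoped Classical in
lemma ups_eq_sum {𝒢 : Set (Set α)} (h𝒢 : 𝒢.Finite) (x : Set α → R) (K : Set α) :
    ups 𝒢 x K = ∑ H ∈ h𝒢.toFinset with K ⊆ H, x H := by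
  rw [ups, ← finsum_mem_coe_finset]
  simp

lemma ups_congr {𝒢 : Set (Set α)} {x y : Set α → R} {K : Set α}
    (h : ∀ H ∈ 𝒢, K ⊆ H → x H = y H) : ups 𝒢 x K = ups 𝒢 y K :=
  finsum_mem_congr rfl fun H hH => h H hH.1 hH.2

lemma map_ups {R' : Type*} [CommRing R'] {𝒢 : Set (Set α)} (h𝒢 : 𝒢.Finite) (f : R →+* R')
    (x : Set α → R) (K : Set α) : f (ups 𝒢 x K) = ups 𝒢 (fun H => f (x H)) K := by
  classical
  rw [ups_eq_sum h𝒢, ups_eq_sum h𝒢, map_sum]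

variable (M : Matroid α) (𝒢 : Set (Set α)) (G : Set α)

/-- The family `x` satisfies the defining relations of the Chow ring of `(M, 𝒢)`. -/
def IsChow (x : Set α → R) : Prop :=
  ∀ K ∈ 𝒢, ∀ S : Finset (Set α), (∀ H ∈ S, H ∈ 𝒢 ∧ H ⊂ K) →
    (∏ H ∈ S, x H) * ups 𝒢 x K ^ (rk M K - rk M (⋃₀ ↑S)) = 0

/-- The element `t` satisfies, together with the family `x`, the relations of the variable indexed
by `G` with the variables indexed by sets not below `G`. -/
def IsExc (x : Set α → R) (t : R) : Prop :=
  ∀ K ∈ 𝒢, G ⊂ K → ∀ S : Finset (Set α), (∀ H ∈ S, H ∈ 𝒢 ∧ ¬ H ⊆ G ∧ H ⊂ K) →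
    t * (∏ H ∈ S, x H) * ups 𝒢 x K ^ (rk M K - rk M (⋃₀ ↑S ∪ G)) = 0

variable {M 𝒢 G}

lemma IsChow.map {R' : Type*} [CommRing R'] {x : Set α → R} (hx : IsChow M 𝒢 x)
    (h𝒢 : 𝒢.Finite) (f : R →+* R') : IsChow M 𝒢 (fun H => f (x H)) := by
  intro K hK S hS
  rw [← map_ups h𝒢, ← map_prod, ← map_pow, ← map_mul, hx K hK S hS, map_zero]

lemma IsChow.mul_eq_zero {x : Set α → R} (hx : IsChow M 𝒢 x) {H K : Set α} (hH : H ∈ 𝒢)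
    (hK : K ∈ 𝒢) (hJ : M.closure (H ∪ K) ∈ 𝒢) (hHJ : H ⊂ M.closure (H ∪ K))
    (hKJ : K ⊂ M.closure (H ∪ K)) (hne : H ≠ K) : x H * x K = 0 := by
  classical
  have := hx _ hJ {H, K} (by simp [hH, hK, hHJ, hKJ])
  simpa [Finset.prod_pair hne] using this

end

namespace IsCenter

variable {R : Type*} [CommRing R] {M : Matroid α} {𝒢 : Set (Set α)} {G : Set α}

section Exc

variable {x : Set α → R} {t : R}

/-- The exceptional relation at the join of `H` and `G`, with `S = {H}`, has exponent zero. -/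
lemma mul_eq_zero_of_notMem_link (h : IsCenter M 𝒢 G) (hx : IsExc M 𝒢 G x t) {H : Set α}
    (hH : H ∈ 𝒢) (hHG : ¬ H ⊆ G) (hl : H ∉ link M 𝒢 G) : t * x H = 0 := by
  obtain ⟨h1, h2⟩ := join_mem_of_notMem_link hH hHG hl
  have h3 := h.subset_join hH
  have := hx _ h1 (h.center_ssubset_join hH hHG) {H} (by
    simp only [Finset.mem_singleton, forall_eq]
    exact ⟨hH, hHG, Set.subset_union_left.trans h3,
      fun h' => h2 (Set.subset_union_right.trans (h3.trans h'))⟩)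
  simpa using this

/-- Only linked sets survive multiplication by `t` here, and a linked set above `K` contains `G`,
hence the join. -/
lemma mul_ups_join (h : IsCenter M 𝒢 G) (hx : IsExc M 𝒢 G x t) {K : Set α} (hK : K ∈ 𝒢)
    (hKG : ¬ K ⊆ G) (hJ : M.closure (K ∪ G) ∈ 𝒢) :
    t * ups 𝒢 x K = t * ups 𝒢 x (M.closure (K ∪ G)) := by
  classical
  rw [ups_eq_sum h.finite, ups_eq_sum h.finite, Finset.mul_sum, Finset.mul_sum]
  symm
  refine Finset.sum_subset ?_ ?_
  · intro H
    simp only [Finset.mem_filter, Set.Finite.mem_toFinset]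
    exact fun hH => ⟨hH.1, Set.subset_union_left.trans ((h.subset_join hK).trans hH.2)⟩
  · intro H
    simp only [Finset.mem_filter, Set.Finite.mem_toFinset]
    rintro ⟨hH, hKH⟩ hH'
    refine h.mul_eq_zero_of_notMem_link hx hH (fun h' => hKG (hKH.trans h')) fun hl => hH' ⟨hH, ?_⟩
    exact h.join_subset hH (h.center_subset_of_link hK hKG hJ hl hKH) hKH

lemma exc_of_join_mem (h : IsCenter M 𝒢 G) (hx : IsExc M 𝒢 G x t) {K : Set α} (hK : K ∈ 𝒢)
    (hKG : ¬ K ⊆ G) (hJ : M.closure (K ∪ G) ∈ 𝒢) {S : Finset (Set α)}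
    (hS : ∀ H ∈ S, H ∈ 𝒢 ∧ ¬ H ⊆ G ∧ H ⊂ K) :
    t * (∏ H ∈ S, x H) * ups 𝒢 x K ^ (rk M (K ∪ G) - rk M (⋃₀ ↑S ∪ G)) = 0 := by
  rw [mul_right_comm, mul_pow_congr (h.mul_ups_join hx hK hKG hJ), mul_right_comm,
    ← rk_closure (K ∪ G)]
  exact hx _ hJ (h.center_ssubset_join hK hKG) S fun H hH => ⟨(hS H hH).1, (hS H hH).2.1,
    (hS H hH).2.2.trans_subset (Set.subset_union_left.trans (h.subset_join hK))⟩

lemma sUnion_subset_of_ssubset {S : Finset (Set α)} {K : Set α} (hS : ∀ H ∈ S, H ⊂ K) :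
    ⋃₀ (S : Set (Set α)) ⊆ K := Set.sUnion_subset fun H hH => (hS H hH).1

/-- If the join of `K` and `G` is a member, its own relation applies; if not, `K` and `G` are skew
and the exponent is that of the Chow relation at `K`. -/
lemma exc_of_isChow [M.Finite] (h : IsCenter M 𝒢 G) (hx : IsExc M 𝒢 G x t) (hc : IsChow M 𝒢 x)
    {K : Set α} (hK : K ∈ 𝒢) (hKG : ¬ K ⊆ G) {S : Finset (Set α)}
    (hS : ∀ H ∈ S, H ∈ 𝒢 ∧ ¬ H ⊆ G ∧ H ⊂ K) :
    t * (∏ H ∈ S, x H) * ups 𝒢 x K ^ (rk M (K ∪ G) - rk M (⋃₀ ↑S ∪ G)) = 0 := by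
  by_cases hJ : M.closure (K ∪ G) ∈ 𝒢
  · exact h.exc_of_join_mem hx hK hKG hJ hS
  · have h1 := (h.transversal K hK hKG hJ).2.1
    have h2 := rk_union_eq_of_subset h1 (sUnion_subset_of_ssubset fun H hH => (hS H hH).2.2)
    rw [h1, h2, Nat.add_sub_add_right, mul_assoc, hc K hK S fun H hH => ⟨(hS H hH).1,
      (hS H hH).2.2⟩, mul_zero]

lemma sUnion_filter_union (S : Finset (Set α)) [DecidablePred fun H : Set α => ¬ H ⊆ G] :
    ⋃₀ (↑(S.filter fun H => ¬ H ⊆ G) : Set (Set α)) ∪ G = ⋃₀ ↑S ∪ G := by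
  ext e
  simp only [Finset.coe_filter, Set.mem_union, Set.mem_sUnion, Set.mem_ofPred_eq]
  grind

/-- Families which agree off the factors of `G` and are congruent modulo `t` on them satisfy the
same relations. -/
lemma prod_mul_pow_eq [M.Finite] (h : IsCenter M 𝒢 G) {f g : Set α → R} (hx : IsExc M 𝒢 G f t)
    (hfg : ∀ H ∈ 𝒢, H ∉ factors (restr 𝒢 G) → f H = g H) (ht : ∀ H ∈ 𝒢, t ∣ f H - g H)
    {K : Set α} (hK : K ∈ 𝒢) {S : Finset (Set α)} (hS : ∀ H ∈ S, H ∈ 𝒢 ∧ H ⊂ K) :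
    (∏ H ∈ S, f H) * ups 𝒢 f K ^ (rk M K - rk M (⋃₀ ↑S)) =
      (∏ H ∈ S, g H) * ups 𝒢 f K ^ (rk M K - rk M (⋃₀ ↑S)) := by
  classical
  by_cases hSG : ∃ H ∈ S, H ∈ factors (restr 𝒢 G)
  -- A factor below `K` forces the join of `K` with `G` into `𝒢`. The two products differ by a
  -- multiple of `t` times the variables not below `G`, which the exceptional relation kills, its
  -- exponent being no larger.
  · obtain ⟨L, hLS, hL⟩ := hSG
    have hKG : ¬ K ⊆ G := not_factor_ssubset hL hK (hS L hLS).2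
    have hJ : M.closure (K ∪ G) ∈ 𝒢 := h.closure_center_mem K hK hKG
      ((h.nonempty L (hS L hLS).1).mono (Set.subset_inter (hS L hLS).2.1 (factor_subset hL)))
    set y := ups 𝒢 f K
    have hd : t ∣ ∏ H ∈ S with H ⊆ G, f H - ∏ H ∈ S with H ⊆ G, g H :=
      dvd_prod_sub_prod fun H hH => ht H (hS H (Finset.mem_filter.1 hH).1).1
    obtain ⟨q, hq⟩ := hd
    rw [← Finset.prod_filter_mul_prod_filter_not S (· ⊆ G) f,
      ← Finset.prod_filter_mul_prod_filter_not S (· ⊆ G) g]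
    have h1 : ∏ H ∈ S with ¬ H ⊆ G, f H = ∏ H ∈ S with ¬ H ⊆ G, g H := by
      refine Finset.prod_congr rfl fun H hH => ?_
      rw [Finset.mem_filter] at hH
      exact hfg H (hS H hH.1).1 fun h' => hH.2 (factor_subset h')
    rw [← h1, ← sub_eq_zero, ← sub_mul, ← sub_mul, hq]
    have h2 := h.exc_of_join_mem hx hK hKG hJ (S := S.filter fun H => ¬ H ⊆ G) (by
      simp only [Finset.mem_filter]
      exact fun H hH => ⟨(hS H hH.1).1, hH.2, (hS H hH.1).2⟩)
    rw [sUnion_filter_union] at h2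
    have h3 := mul_pow_eq_zero_of_le h2
      (rk_join_sub_le (sUnion_subset_of_ssubset fun H hH => (hS H hH).2))
    rw [show t * q * (∏ H ∈ S with ¬ H ⊆ G, f H) * y ^ (rk M K - rk M (⋃₀ ↑S)) =
      q * (t * (∏ H ∈ S with ¬ H ⊆ G, f H) * y ^ (rk M K - rk M (⋃₀ ↑S))) by ring, h3, mul_zero]
  · push Not at hSG
    rw [Finset.prod_congr rfl fun H hH => hfg H (hS H hH).1 (hSG H hH)]

end Exc

end IsCenter

end

/-! ### Changing variables along the blow-up, in both directions. -/

section

variable {α : Type*}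

namespace IsCenter

variable {R : Type*} [CommRing R] {M : Matroid α} {𝒢 : Set (Set α)} {G : Set α}

/-- The product of the variables indexed by the factors of the center. -/
def factorProd (h : IsCenter M 𝒢 G) (x : Set α → R) : R := ∏ L ∈ h.finite_factors.toFinset, x L

/-- Adjoin all factors to `S`: their union is `G`, so the Chow exponent becomes the exceptional one.
-/
lemma isExc_factorProd (h : IsCenter M 𝒢 G) {x : Set α → R} (hx : IsChow M 𝒢 x) :
    IsExc M 𝒢 G x (h.factorProd x) := by
  classical
  intro K hK hGK S hS
  have hd : Disjoint h.finite_factors.toFinset S := by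
    refine Finset.disjoint_left.2 fun L hL hL' => (hS L hL').2.1 ?_
    exact factor_subset (h.finite_factors.mem_toFinset.1 hL)
  have := hx K hK (h.finite_factors.toFinset ∪ S) (by
    simp only [Finset.mem_union, Set.Finite.mem_toFinset]
    rintro H (hH | hH)
    · exact ⟨factor_mem hH, (h.factor_ssubset hH).trans hGK⟩
    · exact ⟨(hS H hH).1, (hS H hH).2.2⟩)
  rw [Finset.prod_union hd, Finset.coe_union, Set.Finite.coe_toFinset, Set.sUnion_union,
    h.sUnion_factors, Set.union_comm] at this
  exact this

open scoped Classical in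
-- Factors are disjoint, so just one lies above a nonempty `K ⊆ G`. This is why correcting the
-- factor variables alone keeps the sums `ups` right.
lemma sum_ite_factor (h : IsCenter M 𝒢 G) (c : R) {K : Set α} (hK : K ∈ 𝒢) :
    ∑ H ∈ h.finite.toFinset with K ⊆ H, (if H ∈ factors (restr 𝒢 G) then c else 0) =
      if K ⊆ G then c else 0 := by
  split_ifs with hKG
  · obtain ⟨L, hL, hKL⟩ := h.exists_le K hK hKG
    rw [Finset.sum_eq_single_of_mem L (by simp [factor_mem hL, hKL]), if_pos hL]
    intro H hH hne
    rw [Finset.mem_filter, Set.Finite.mem_toFinset] at hH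
    exact if_neg fun h' => hne (h.factor_eq_of_subset hK h' hL hH.2 hKL)
  · refine Finset.sum_eq_zero fun H hH => if_neg fun h' => hKG ?_
    exact (Finset.mem_filter.1 hH).2.trans (factor_subset h')

open scoped Classical in
lemma ups_insert (h : IsCenter M 𝒢 G) (x : Set α → R) (K : Set α) :
    ups (insert G 𝒢) x K = (if K ⊆ G then x G else 0) + ups 𝒢 x K := by
  rw [ups_eq_sum (h.finite.insert G), ups_eq_sum h.finite]
  have : (h.finite.insert G).toFinset = insert G h.finite.toFinset := by ext; simp
  rw [this, Finset.filter_insert]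
  split_ifs
  · rw [Finset.sum_insert (by simp [h.notMem])]
  · rw [zero_add]

open scoped Classical in
/-- Sums over the sets above `K`, before and after adding the center. -/
lemma ups_insert_center (h : IsCenter M 𝒢 G) {x y : Set α → R}
    (hxy : ∀ H ∈ 𝒢, y H = x H + if H ∈ factors (restr 𝒢 G) then x G else 0)
    {K : Set α} (hK : K ∈ 𝒢) : ups (insert G 𝒢) x K = ups 𝒢 y K := by
  rw [h.ups_insert, ups_congr fun H hH _ => hxy H hH, ups_eq_sum h.finite, ups_eq_sum h.finite,
    Finset.sum_add_distrib, h.sum_ite_factor _ hK, add_comm]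

section Pullback

open scoped Classical in
/-- The pullbacks of the variables under the blow-up of `G`. -/
def pullback (_ : IsCenter M 𝒢 G) (x : Set α → R) (H : Set α) : R :=
  x H + if H ∈ factors (restr 𝒢 G) then x G else 0

lemma pullback_of_mem (h : IsCenter M 𝒢 G) (x : Set α → R) {L : Set α}
    (hL : L ∈ factors (restr 𝒢 G)) : h.pullback x L = x L + x G := by simp [pullback, hL]

lemma pullback_of_notMem (h : IsCenter M 𝒢 G) (x : Set α → R) {H : Set α}
    (hH : H ∉ factors (restr 𝒢 G)) : h.pullback x H = x H := by simp [pullback, hH]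

lemma ups_pullback (h : IsCenter M 𝒢 G) (x : Set α → R) {K : Set α} (hK : K ∈ 𝒢) :
    ups 𝒢 (h.pullback x) K = ups (insert G 𝒢) x K :=
  (h.ups_insert_center (fun _ _ => rfl) hK).symm

lemma dvd_pullback_sub (h : IsCenter M 𝒢 G) (x : Set α → R) (H : Set α) :
    x G ∣ h.pullback x H - x H := by
  rw [pullback, add_sub_cancel_left]
  split_ifs <;> simp

variable {x : Set α → R}

lemma isExc_pullback (h : IsCenter M 𝒢 G) (hx : IsChow M (insert G 𝒢) x) :
    IsExc M 𝒢 G (h.pullback x) (x G) := by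
  classical
  intro K hK hGK S hS
  have hG : G ∉ S := fun hG => (hS G hG).2.1 subset_rfl
  have := hx K (Or.inr hK) (insert G S) (by
    simp only [Finset.mem_insert, forall_eq_or_imp]
    exact ⟨⟨Or.inl rfl, hGK⟩, fun H hH => ⟨Or.inr (hS H hH).1, (hS H hH).2.2⟩⟩)
  rw [Finset.prod_insert hG, Finset.coe_insert, Set.sUnion_insert, Set.union_comm] at this
  rwa [h.ups_pullback x hK, Finset.prod_congr rfl fun H hH =>
    h.pullback_of_notMem x fun h' => (hS H hH).2.1 (factor_subset h')]

/-- The sums agree by `ups_pullback`, and `prod_mul_pow_eq` exchanges the corrected variables in the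
product for the original ones. -/
lemma isChow_pullback [M.Finite] (h : IsCenter M 𝒢 G) (hx : IsChow M (insert G 𝒢) x) :
    IsChow M 𝒢 (h.pullback x) := by
  intro K hK S hS
  rw [h.prod_mul_pow_eq (h.isExc_pullback hx) (fun H _ => h.pullback_of_notMem x)
    (fun H _ => h.dvd_pullback_sub x H) hK hS, h.ups_pullback x hK]
  exact hx K (Or.inr hK) S fun H hH => ⟨Or.inr (hS H hH).1, (hS H hH).2⟩

/-- This is the Chow relation of `G` with all factors in `S`, where the exponent vanishes. -/
lemma factorProd_pullback_sub (h : IsCenter M 𝒢 G) (hx : IsChow M (insert G 𝒢) x) :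
    ∏ L ∈ h.finite_factors.toFinset, (h.pullback x L - x G) = 0 := by
  have := hx G (Or.inl rfl) h.finite_factors.toFinset (by
    simp only [Set.Finite.mem_toFinset]
    exact fun L hL => ⟨Or.inr (factor_mem hL), h.factor_ssubset hL⟩)
  rw [Set.Finite.coe_toFinset, h.sUnion_factors, Nat.sub_self, pow_zero, mul_one] at this
  rw [← this]
  refine Finset.prod_congr rfl fun L hL => ?_
  rw [h.pullback_of_mem x (h.finite_factors.mem_toFinset.1 hL), add_sub_cancel_right]

end Pullback

section Strict

open scoped Classical in
/-- The variables after the blow-up of `G`, with `T` the class of the exceptional divisor. -/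
def strict (_ : IsCenter M 𝒢 G) (x : Set α → R) (T : R) (H : Set α) : R :=
  if H = G then T else x H - if H ∈ factors (restr 𝒢 G) then T else 0

variable {x : Set α → R} {T : R}

@[simp] lemma strict_center (h : IsCenter M 𝒢 G) : h.strict x T G = T := if_pos rfl

open scoped Classical in
lemma strict_of_mem (h : IsCenter M 𝒢 G) {H : Set α} (hH : H ∈ 𝒢) :
    h.strict x T H = x H - if H ∈ factors (restr 𝒢 G) then T else 0 :=
  if_neg (by rintro rfl; exact h.notMem hH)

lemma strict_of_mem_factors (h : IsCenter M 𝒢 G) {H : Set α} (hH : H ∈ factors (restr 𝒢 G)) :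
    h.strict x T H = x H - T := by rw [h.strict_of_mem (factor_mem hH), if_pos hH]

lemma strict_of_notMem_factors (h : IsCenter M 𝒢 G) {H : Set α} (hH : H ∈ 𝒢)
    (hH' : H ∉ factors (restr 𝒢 G)) : h.strict x T H = x H := by
  rw [h.strict_of_mem hH, if_neg hH', sub_zero]

lemma ups_strict (h : IsCenter M 𝒢 G) {K : Set α} (hK : K ∈ 𝒢) :
    ups (insert G 𝒢) (h.strict x T) K = ups 𝒢 x K := by
  refine h.ups_insert_center (fun H hH => ?_) hK
  rw [h.strict_of_mem hH, h.strict_center, sub_add_cancel]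

lemma ups_strict_center (h : IsCenter M 𝒢 G) :
    ups (insert G 𝒢) (h.strict x T) G = T + ups 𝒢 x G := by
  rw [h.ups_insert, if_pos subset_rfl, h.strict_center]
  congr 1
  refine ups_congr fun H hH hGH => h.strict_of_notMem_factors hH fun hH' => ?_
  exact (h.factor_ssubset hH').2 hGH

lemma dvd_strict_sub (h : IsCenter M 𝒢 G) {H : Set α} (hH : H ∈ 𝒢) :
    T ∣ x H - h.strict x T H := by
  rw [h.strict_of_mem hH, sub_sub_cancel]
  split_ifs <;> simp

lemma strict_rel_of_notMem [M.Finite] (h : IsCenter M 𝒢 G) (hx : IsChow M 𝒢 x)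
    (ht : IsExc M 𝒢 G x T) {K : Set α} (hK : K ∈ 𝒢) {S : Finset (Set α)}
    (hS : ∀ H ∈ S, H ∈ 𝒢 ∧ H ⊂ K) :
    (∏ H ∈ S, h.strict x T H) * ups 𝒢 x K ^ (rk M K - rk M (⋃₀ ↑S)) = 0 := by
  rw [← h.prod_mul_pow_eq ht (fun H hH hH' => (h.strict_of_notMem_factors hH hH').symm)
    (fun H hH => h.dvd_strict_sub hH) hK hS]
  exact hx K hK S hS

lemma strict_rel_of_mem [M.Finite] (h : IsCenter M 𝒢 G)
    (ht : IsExc M 𝒢 G x T) {K : Set α} (hK : K ∈ 𝒢) (hGK : G ⊂ K) {S : Finset (Set α)}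
    (hS : ∀ H ∈ S, H ∈ 𝒢 ∧ H ⊂ K) :
    T * (∏ H ∈ S, h.strict x T H) * ups 𝒢 x K ^ (rk M K - rk M (⋃₀ ↑S ∪ G)) = 0 := by
  classical
  have h1 := ht K hK hGK (S.filter fun H => ¬ H ⊆ G) (by
    simp only [Finset.mem_filter]
    exact fun H hH => ⟨(hS H hH.1).1, hH.2, (hS H hH.1).2⟩)
  rw [sUnion_filter_union] at h1
  have h2 : ∏ H ∈ S with ¬ H ⊆ G, h.strict x T H = ∏ H ∈ S with ¬ H ⊆ G, x H := by
    refine Finset.prod_congr rfl fun H hH => ?_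
    rw [Finset.mem_filter] at hH
    exact h.strict_of_notMem_factors (hS H hH.1).1 fun h' => hH.2 (factor_subset h')
  rw [← Finset.prod_filter_mul_prod_filter_not S (· ⊆ G), h2, mul_left_comm, mul_assoc, h1,
    mul_zero]

/-- A set above a factor `L` but not comparable to `G` annihilates the relevant power of the sum
over the sets above `G`. -/
lemma strict_mul_pow_eq_zero [M.Finite] (h : IsCenter M 𝒢 G) (hx : IsChow M 𝒢 x)
    (ht : IsExc M 𝒢 G x T) {L H : Set α} (hL : L ∈ 𝒢) (hLG : L ⊆ G) (hH : H ∈ 𝒢) (hLH : L ⊆ H)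
    (hHG : ¬ H ⊆ G) (hGH : ¬ G ⊆ H) {S : Finset (Set α)} (hS : ∀ K ∈ S, K ∈ 𝒢 ∧ K ⊆ G) :
    x H * ((∏ K ∈ S, h.strict x T K) *
      (T + ups 𝒢 x G) ^ (rk M G - rk M (⋃₀ ↑S ∪ L))) = 0 := by
  classical
  have hne : (H ∩ G).Nonempty := (h.nonempty L hL).mono (Set.subset_inter hLH hLG)
  have hJ := h.closure_center_mem H hH hHG hne
  -- `H` meets `G` without containing it, so it is not linked, and `T` can be dropped next to `x H`.
  have hT : x H * T = 0 := by
    rw [mul_comm]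
    exact h.mul_eq_zero_of_notMem_link ht hH hHG (h.notMem_link_of_meets hGH hne)
  have h1 : x H * ∏ K ∈ S, h.strict x T K = x H * ∏ K ∈ S, x K := by
    obtain ⟨q, hq⟩ := dvd_prod_sub_prod (S := S) fun K hK =>
      h.dvd_strict_sub (x := x) (T := T) (hS K hK).1
    rw [eq_comm, ← sub_eq_zero, ← mul_sub, hq, ← mul_assoc, hT, zero_mul]
  -- A `K ⊇ G` not above `H` meets `H`; their join is a member strictly above both, so `x H * x K =
  -- 0`. Only the sets above the join of `H` and `G` remain.
  have h2 : x H * (T + ups 𝒢 x G) = x H * ups 𝒢 x (M.closure (H ∪ G)) := by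
    rw [mul_add, hT, zero_add, ups_eq_sum h.finite, ups_eq_sum h.finite, Finset.mul_sum,
      Finset.mul_sum]
    symm
    refine Finset.sum_subset ?_ ?_
    · intro K
      simp only [Finset.mem_filter, Set.Finite.mem_toFinset]
      exact fun hK => ⟨hK.1, (h.center_ssubset_join hH hHG).1.trans hK.2⟩
    · intro K
      simp only [Finset.mem_filter, Set.Finite.mem_toFinset]
      rintro ⟨hK, hGK⟩ hK'
      have hHK : ¬ H ⊆ K := fun h' => hK' ⟨hK, h.join_subset hK hGK h'⟩
      have hs : H ∪ K ⊆ M.closure (H ∪ K) := M.subset_closure _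
        (Set.union_subset (h.isFlat _ hH).subset_ground (h.isFlat _ hK).subset_ground)
      refine hx.mul_eq_zero hH hK (h.closure_mem H hH K hK
        (hne.mono (Set.inter_subset_inter_right H hGK)))
        ⟨Set.subset_union_left.trans hs, fun h' => hGH ?_⟩
        ⟨Set.subset_union_right.trans hs, fun h' => hHK ?_⟩ fun h' => hHK h'.subset
      · exact hGK.trans (Set.subset_union_right.trans (hs.trans h'))
      · exact Set.subset_union_left.trans (hs.trans h')
  rw [← mul_assoc, h1, mul_right_comm, mul_pow_congr h2, mul_right_comm]
  have hHS : H ∉ S := fun h' => hHG (hS H h').2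
  have hHJ := Set.subset_union_left.trans (h.subset_join hH)
  have h3 := hx _ hJ (insert H S) (by
    simp only [Finset.mem_insert, forall_eq_or_imp]
    refine ⟨⟨hH, hHJ, fun h' => hGH ((h.center_ssubset_join hH hHG).1.trans h')⟩, fun K hK =>
      ⟨(hS K hK).1, (hS K hK).2.trans_ssubset (h.center_ssubset_join hH hHG)⟩⟩)
  rw [Finset.prod_insert hHS, Finset.coe_insert, Set.sUnion_insert, rk_closure] at h3
  refine mul_pow_eq_zero_of_le h3 ?_
  have hSG : ⋃₀ (S : Set (Set α)) ⊆ G := Set.sUnion_subset fun K hK => (hS K hK).2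
  have h4 := rk_submod (M := M) G (H ∪ ⋃₀ ↑S)
  have h5 : G ∪ (H ∪ ⋃₀ ↑S) = H ∪ G := by
    rw [Set.union_left_comm, Set.union_eq_left.2 hSG]
  have h6 : rk M (⋃₀ ↑S ∪ L) ≤ rk M (G ∩ (H ∪ ⋃₀ ↑S)) :=
    rk_mono (Set.subset_inter (Set.union_subset hSG hLG)
      (Set.union_subset Set.subset_union_right (hLH.trans Set.subset_union_left)))
  rw [h5] at h4
  omega

end Strict

end IsCenter

end

/-! ### The relation at the center itself. -/

section

variable {α : Type*}

namespace IsCenter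

variable {R : Type*} [CommRing R] {M : Matroid α} {𝒢 : Set (Set α)} {G : Set α}
  {x : Set α → R} {T : R}

open scoped Classical in
-- Let `x'` be the new variables, `U = T + ups G`, and `D` the sum over the sets above `L`
-- incomparable with `G`; the sum above `L` is `x' L + U + D`. In the Chow relation at `L`, a power
-- of this sum, `D` dies by `strict_mul_pow_eq_zero` and `x' L` by the relation for `insert L S`.
-- What is left is a power of `U`.
lemma strict_rel_center_step [M.Finite] (h : IsCenter M 𝒢 G) (hx : IsChow M 𝒢 x)
    (ht : IsExc M 𝒢 G x T) {L : Set α} (hL : L ∈ factors (restr 𝒢 G)) {S : Finset (Set α)}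
    (hS : ∀ H ∈ S, H ∈ 𝒢 ∧ H ⊆ G) (hLS : L ∉ S)
    (hrec : (∏ H ∈ insert L S, h.strict x T H) *
      (T + ups 𝒢 x G) ^ (rk M G - rk M (⋃₀ ↑(insert L S))) = 0) :
    (∏ H ∈ S, h.strict x T H) * (T + ups 𝒢 x G) ^ (rk M G - rk M (⋃₀ ↑S)) = 0 := by
  set U := T + ups 𝒢 x G with hU
  set x' := h.strict x T with hx'
  have hLG := factor_subset hL
  have hLm := factor_mem hL
  set S₁ := S.filter (· ⊆ L) with hS₁
  set S₂ := S.filter (¬ · ⊆ L) with hS₂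
  have hS₁L : ⋃₀ (S₁ : Set (Set α)) ⊆ L :=
    Set.sUnion_subset fun H hH => (Finset.mem_filter.1 hH).2
  have hS₂G : ⋃₀ (S₂ : Set (Set α)) ⊆ G :=
    Set.sUnion_subset fun H hH => (hS H (Finset.mem_filter.1 hH).1).2
  have hSu : ⋃₀ (S : Set (Set α)) = ⋃₀ ↑S₁ ∪ ⋃₀ ↑S₂ := by
    rw [← Set.sUnion_union, ← Finset.coe_union, Finset.filter_union_filter_not_eq]
  have hd : ⋃₀ (S₂ : Set (Set α)) ∩ L = ∅ := by
    refine Set.eq_empty_of_forall_notMem ?_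
    rintro e ⟨⟨H, hH, he⟩, heL⟩
    obtain ⟨hH, hHL⟩ := Finset.mem_filter.1 hH
    obtain ⟨L', hL', hHL'⟩ := h.exists_le H (hS H hH).1 (hS H hH).2
    exact hHL (h.disjoint L hL L' hL' ⟨e, heL, hHL' he⟩ ▸ hHL')
  have hsk := h.skew L hL _ hS₂G hd
  have hrU : rk M (⋃₀ ↑(insert L S)) = rk M (⋃₀ ↑S₂ ∪ L) := by
    rw [Finset.coe_insert, Set.sUnion_insert, hSu, ← Set.union_assoc, Set.union_eq_left.2 hS₁L,
      Set.union_comm]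
  have hr₁ : rk M (⋃₀ ↑S₁) ≤ rk M L := rk_mono hS₁L
  have hr₂ : rk M (⋃₀ ↑S₂ ∪ L) ≤ rk M G := rk_mono (Set.union_subset hS₂G hLG)
  have hr₃ := rk_union_le (M := M) (⋃₀ ↑S₁) (⋃₀ ↑S₂)
  rw [← hSu] at hr₃
  rw [hrU] at hrec
  set e₁ := rk M L - rk M (⋃₀ ↑S₁) with he₁
  set e₂ := rk M G - rk M (⋃₀ ↑S₂ ∪ L) with he₂
  -- `L` is skew to the part of `S` off `L`, so `e₁ + e₂` is `rk G` minus the ranks of the two parts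
  -- of `S`; subadditivity bounds it by the wanted exponent.
  refine mul_pow_eq_zero_of_le (m := e₁ + e₂) ?_ (by omega)
  -- the sum over the sets above `L`
  set Dset := h.finite.toFinset.filter (fun H => L ⊆ H ∧ ¬ H ⊆ G ∧ ¬ G ⊆ H) with hDset
  set D := ∑ H ∈ Dset, x H with hD
  have hy : ups 𝒢 x L - x' L = U + D := by
    rw [hx', h.strict_of_mem_factors hL, hU, hD, ups_eq_sum h.finite, ups_eq_sum h.finite]
    have h1 : h.finite.toFinset.filter (L ⊆ ·) =
        insert L (h.finite.toFinset.filter (G ⊆ ·) ∪ Dset) := by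
      ext H
      simp only [hDset, Finset.mem_insert, Finset.mem_union, Finset.mem_filter,
        Set.Finite.mem_toFinset]
      constructor
      · rintro ⟨hH, hLH⟩
        by_cases hHL : H = L
        · exact Or.inl hHL
        · have := not_factor_ssubset hL hH (hLH.ssubset_of_ne (Ne.symm hHL))
          tauto
      · rintro (rfl | ⟨hH, hGH⟩ | hH)
        · exact ⟨hLm, subset_rfl⟩
        · exact ⟨hH, hLG.trans hGH⟩
        · exact ⟨hH.1, hH.2.1⟩
    rw [h1, Finset.sum_insert, Finset.sum_union]
    · ring
    · refine Finset.disjoint_left.2 fun H hH hH' => ?_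
      exact (Finset.mem_filter.1 hH').2.2.2 (Finset.mem_filter.1 hH).2
    · simp only [hDset, Finset.mem_union, Finset.mem_filter]
      have := (h.factor_ssubset hL).2
      tauto
  have hD0 : D * ((∏ H ∈ S₂, x' H) * U ^ e₂) = 0 := by
    rw [hD, Finset.sum_mul]
    refine Finset.sum_eq_zero fun H hH => ?_
    simp only [hDset, Finset.mem_filter, Set.Finite.mem_toFinset] at hH
    exact h.strict_mul_pow_eq_zero hx ht hLm hLG hH.1 hH.2.1 hH.2.2.1 hH.2.2.2
      fun K hK => hS K (Finset.mem_filter.1 hK).1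
  have hrel : (∏ H ∈ S₁, x' H) * ups 𝒢 x L ^ e₁ = 0 := by
    have hS₁' : ∀ H ∈ S₁, H ∈ 𝒢 ∧ H ⊂ L := fun H hH => by
      obtain ⟨hH, hHL⟩ := Finset.mem_filter.1 hH
      exact ⟨(hS H hH).1, hHL.ssubset_of_ne fun h' => hLS (h' ▸ hH)⟩
    have h1 : ∏ H ∈ S₁, x' H = ∏ H ∈ S₁, x H :=
      Finset.prod_congr rfl fun H hH => h.strict_of_notMem_factors (hS₁' H hH).1 fun h' =>
        not_factor_ssubset h' hLm (hS₁' H hH).2 hLG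
    rw [h1]
    exact hx L hLm S₁ hS₁'
  obtain ⟨q, hq⟩ : x' L ∣ ups 𝒢 x L ^ e₁ - (U + D) ^ e₁ := by
    rw [← hy]
    refine dvd_trans ?_ (sub_dvd_pow_sub_pow _ _ e₁)
    rw [sub_sub_cancel]
  obtain ⟨r, hr⟩ : D ∣ (U + D) ^ e₁ - U ^ e₁ := by
    refine dvd_trans ?_ (sub_dvd_pow_sub_pow _ _ e₁)
    rw [add_sub_cancel_left]
  rw [Finset.prod_insert hLS] at hrec
  have hsplit := Finset.prod_filter_mul_prod_filter_not S (· ⊆ L) x'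
  rw [← hS₁, ← hS₂] at hsplit
  rw [← hsplit] at hrec ⊢
  rw [pow_add]
  linear_combination (∏ H ∈ S₂, x' H) * U ^ e₂ * hrel - (∏ H ∈ S₁, x' H) * r * hD0 - q * hrec -
    (∏ H ∈ S₁, x' H) * (∏ H ∈ S₂, x' H) * U ^ e₂ * hq -
    (∏ H ∈ S₁, x' H) * (∏ H ∈ S₂, x' H) * U ^ e₂ * hr

/-- Induction on the number of factors missing from `S`; when none is missing, the product contains
`∏ (x L - T) = 0`. -/
lemma strict_rel_center [M.Finite] (h : IsCenter M 𝒢 G) (hx : IsChow M 𝒢 x)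
    (ht : IsExc M 𝒢 G x T) (hP : ∏ L ∈ h.finite_factors.toFinset, (x L - T) = 0) (n : ℕ)
    {S : Finset (Set α)} (hS : ∀ H ∈ S, H ∈ 𝒢 ∧ H ⊆ G)
    (hn : (factors (restr 𝒢 G) \ ↑S).ncard = n) :
    (∏ H ∈ S, h.strict x T H) * (T + ups 𝒢 x G) ^ (rk M G - rk M (⋃₀ ↑S)) = 0 := by
  classical
  induction n generalizing S with
  | zero =>
    rw [Set.ncard_eq_zero (h.finite_factors.subset Set.sdiff_subset), Set.sdiff_eq_empty] at hn
    have hsub : h.finite_factors.toFinset ⊆ S := fun L hL =>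
      hn (h.finite_factors.mem_toFinset.1 hL)
    rw [← Finset.prod_sdiff hsub, ← Finset.prod_congr rfl fun L hL =>
      (h.strict_of_mem_factors (h.finite_factors.mem_toFinset.1 hL)).symm, hP, mul_zero, zero_mul]
  | succ n ih =>
    have hne : (factors (restr 𝒢 G) \ ↑S).Nonempty := by
      rw [← Set.ncard_pos (h.finite_factors.subset Set.sdiff_subset)]; omega
    obtain ⟨L, hL, hLS⟩ := hne
    refine h.strict_rel_center_step hx ht hL hS hLS (ih ?_ ?_)
    · simp only [Finset.mem_insert, forall_eq_or_imp]
      exact ⟨⟨factor_mem hL, factor_subset hL⟩, hS⟩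
    · have : factors (restr 𝒢 G) \ ↑(insert L S) = (factors (restr 𝒢 G) \ ↑S) \ {L} := by
        ext; simp; tauto
      rw [this, Set.ncard_sdiff_singleton_of_mem (Set.mem_sdiff_of_mem hL hLS), hn, Nat.add_sub_cancel]

lemma isChow_strict [M.Finite] (h : IsCenter M 𝒢 G) (hx : IsChow M 𝒢 x)
    (ht : IsExc M 𝒢 G x T) (hP : ∏ L ∈ h.finite_factors.toFinset, (x L - T) = 0) :
    IsChow M (insert G 𝒢) (h.strict x T) := by
  classical
  rintro K (rfl | hK) S hS
  · rw [h.ups_strict_center]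
    exact h.strict_rel_center hx ht hP _ (fun H hH => ⟨(hS H hH).1.resolve_left
      (hS H hH).2.ne, (hS H hH).2.1⟩) rfl
  · rw [h.ups_strict hK]
    by_cases hGS : G ∈ S
    · rw [← Finset.insert_erase hGS, Finset.prod_insert (Finset.notMem_erase _ _),
        Finset.coe_insert, Set.sUnion_insert, Set.union_comm, h.strict_center]
      refine h.strict_rel_of_mem ht hK (hS G hGS).2 fun H hH => ?_
      rw [Finset.mem_erase] at hH
      exact ⟨(hS H hH.2).1.resolve_left hH.1, (hS H hH.2).2⟩
    · exact h.strict_rel_of_notMem hx ht hK fun H hH =>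
        ⟨(hS H hH).1.resolve_left fun h' => hGS (h' ▸ hH), (hS H hH).2⟩

end IsCenter

end

/-! ### Restriction to the center, and recovering a family from it. -/

section

variable {α : Type*}

lemma finite_restr {𝒢 : Set (Set α)} (h𝒢 : 𝒢.Finite) (F : Set α) : (restr 𝒢 F).Finite :=
  h𝒢.subset (restr_subset 𝒢 F)

lemma IsCenter.finite_contr {M : Matroid α} {𝒢 : Set (Set α)} {G : Set α}
    (h : IsCenter M 𝒢 G) : (contr M 𝒢 G).Finite := by
  rw [h.contr_eq]
  exact (h.finite.subset fun H hH => hH.1).image _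

namespace IsCenter

section Lift

variable {R : Type*} {M : Matroid α} {𝒢 : Set (Set α)} {G : Set α} {x : Set α → R}

open scoped Classical in
/-- The variables of the Chow ring of the contraction of the center. -/
def ofContr (_ : IsCenter M 𝒢 G) (x : Set α → R) (X : Set α) : R :=
  x (Function.invFunOn (· \ G) (link M 𝒢 G) X)

lemma ofContr_sdiff (h : IsCenter M 𝒢 G) {H : Set α} (hH : H ∈ link M 𝒢 G) :
    h.ofContr x (H \ G) = x H :=
  congrArg x (h.injOn_link.leftInvOn_invFunOn hH)

end Lift

variable {R : Type*} [CommRing R] {M : Matroid α} {𝒢 : Set (Set α)} {G : Set α}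

section Restriction

variable {z w : Set α → R}

open scoped Classical in
/-- The restrictions of the variables to the center, in terms of the variables `z` and `w` of the
Chow rings of the restriction and of the contraction. -/
def toCenter (_ : IsCenter M 𝒢 G) (z w : Set α → R) (H : Set α) : R :=
  (if H ⊆ G then z H else 0) -
    (if H ∈ factors (restr 𝒢 G) then ups 𝒢 (fun K => w (K \ G)) G else 0) +
    (if H ∈ link M 𝒢 G then w (H \ G) else 0)

lemma toCenter_of_mem_factors (h : IsCenter M 𝒢 G) {L : Set α} (hL : L ∈ factors (restr 𝒢 G)) :
    h.toCenter z w L = z L - ups 𝒢 (fun K => w (K \ G)) G := by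
  rw [toCenter, if_pos (factor_subset hL), if_pos hL,
    if_neg fun h' : L ∈ link M 𝒢 G => h'.2.1 (factor_subset hL), add_zero]

lemma toCenter_of_subset (h : IsCenter M 𝒢 G) {H : Set α} (hHG : H ⊆ G)
    (hH : H ∉ factors (restr 𝒢 G)) : h.toCenter z w H = z H := by
  rw [toCenter, if_pos hHG, if_neg hH, if_neg fun h' : H ∈ link M 𝒢 G => h'.2.1 hHG, add_zero,
    sub_zero]

lemma toCenter_of_link (h : IsCenter M 𝒢 G) {H : Set α} (hH : H ∈ link M 𝒢 G) :
    h.toCenter z w H = w (H \ G) := by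
  rw [toCenter, if_neg hH.2.1, if_neg fun h' => hH.2.1 (factor_subset h'), if_pos hH, sub_zero,
    zero_add]

lemma toCenter_of_notMem_link (h : IsCenter M 𝒢 G) {H : Set α} (hHG : ¬ H ⊆ G)
    (hH : H ∉ link M 𝒢 G) : h.toCenter z w H = 0 := by
  rw [toCenter, if_neg hHG, if_neg fun h' => hHG (factor_subset h'), if_neg hH, sub_zero,
    zero_add]

open scoped Classical in
lemma sum_restr (h : IsCenter M 𝒢 G) (z : Set α → R) (K : Set α) :
    ∑ H ∈ h.finite.toFinset with K ⊆ H, (if H ⊆ G then z H else 0) = ups (restr 𝒢 G) z K := by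
  rw [ups_eq_sum (finite_restr h.finite G), ← Finset.sum_filter, Finset.filter_filter]
  refine Finset.sum_congr ?_ fun _ _ => rfl
  ext H
  simp only [Finset.mem_filter, Set.Finite.mem_toFinset, restr, Set.mem_ofPred_eq]
  tauto

open scoped Classical in
lemma sum_link_of_subset (h : IsCenter M 𝒢 G) (w : Set α → R) {K : Set α} (hK : K ∈ 𝒢)
    (hKG : K ⊆ G) :
    ∑ H ∈ h.finite.toFinset with K ⊆ H, (if H ∈ link M 𝒢 G then w (H \ G) else 0) =
      ups 𝒢 (fun K => w (K \ G)) G := by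
  rw [ups_eq_sum h.finite, ← Finset.sum_filter, Finset.filter_filter]
  refine Finset.sum_congr ?_ fun _ _ => rfl
  ext H
  simp only [Finset.mem_filter, Set.Finite.mem_toFinset]
  refine ⟨fun ⟨h1, h2, h3⟩ => ⟨h1, ?_⟩, fun ⟨h1, h2⟩ => ⟨h1, hKG.trans h2,
    h.mem_link_of_subset h1 h2⟩⟩
  exact h.subset_of_meets_of_link h3 ((h.nonempty K hK).mono (Set.subset_inter h2 hKG))

open scoped Classical in
lemma sum_link_of_not_subset (h : IsCenter M 𝒢 G) (w : Set α → R) {K : Set α} (hK : K ∈ 𝒢)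
    (hKG : ¬ K ⊆ G) :
    ∑ H ∈ h.finite.toFinset with K ⊆ H, (if H ∈ link M 𝒢 G then w (H \ G) else 0) =
      ups (contr M 𝒢 G) w (M.closure (K ∪ G) \ G) := by
  rw [ups_eq_sum h.finite_contr, ← Finset.sum_filter, Finset.filter_filter]
  refine Finset.sum_bij (fun H _ => H \ G) ?_ ?_ ?_ fun _ _ => rfl
  · intro H hH
    simp only [Finset.mem_filter, Set.Finite.mem_toFinset] at hH ⊢
    rw [h.contr_eq]
    exact ⟨⟨H, hH.2.2, rfl⟩, (h.subset_iff_of_link hK hKG hH.2.2).1 hH.2.1⟩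
  · intro H hH H' hH' he
    simp only [Finset.mem_filter] at hH hH'
    exact h.injOn_link hH.2.2 hH'.2.2 he
  · intro X hX
    simp only [Finset.mem_filter, Set.Finite.mem_toFinset] at hX
    rw [h.contr_eq] at hX
    obtain ⟨⟨H, hH, rfl⟩, hKX⟩ := hX
    refine ⟨H, ?_, rfl⟩
    simp only [Finset.mem_filter, Set.Finite.mem_toFinset]
    exact ⟨hH.1, (h.subset_iff_of_link hK hKG hH).2 hKX, hH⟩

/-- The linked sets above `K` are those above `G`, and the correction at the unique factor above `K`
cancels their sum. -/
lemma ups_toCenter_of_subset (h : IsCenter M 𝒢 G) {K : Set α} (hK : K ∈ 𝒢) (hKG : K ⊆ G) :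
    ups 𝒢 (h.toCenter z w) K = ups (restr 𝒢 G) z K := by
  classical
  rw [ups_eq_sum h.finite]
  simp only [toCenter]
  rw [Finset.sum_add_distrib, Finset.sum_sub_distrib, h.sum_restr, h.sum_ite_factor _ hK,
    if_pos hKG, h.sum_link_of_subset w hK hKG, sub_add_cancel]

lemma ups_toCenter_of_not_subset (h : IsCenter M 𝒢 G) {K : Set α} (hK : K ∈ 𝒢)
    (hKG : ¬ K ⊆ G) :
    ups 𝒢 (h.toCenter z w) K = ups (contr M 𝒢 G) w (M.closure (K ∪ G) \ G) := by
  classical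
  rw [ups_eq_sum h.finite]
  simp only [toCenter]
  rw [Finset.sum_add_distrib, Finset.sum_sub_distrib, h.sum_ite_factor _ hK, if_neg hKG, sub_zero,
    h.sum_link_of_not_subset w hK hKG, Finset.sum_eq_zero, zero_add]
  intro H hH
  exact if_neg fun h' => hKG ((Finset.mem_filter.1 hH).2.trans h')

lemma rk_contract_sub [M.Finite] (G X Y : Set α) :
    rk (M ／ G) X - rk (M ／ G) Y = rk M (X ∪ G) - rk M (Y ∪ G) := by
  rw [← rk_contract, ← rk_contract, Nat.add_sub_add_right]

/-- Non-linked variables restrict to zero; if all of `S` is linked, this is the relation of the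
contraction at the image of `K`. -/
lemma toCenter_rel_of_not_subset [M.Finite] (h : IsCenter M 𝒢 G)
    (hw : IsChow (M ／ G) (contr M 𝒢 G) w) {K : Set α} (hK : K ∈ 𝒢) (hKG : ¬ K ⊆ G)
    {S : Finset (Set α)} (hS : ∀ H ∈ S, H ∈ 𝒢 ∧ ¬ H ⊆ G ∧ H ⊂ K) :
    (∏ H ∈ S, h.toCenter z w H) *
      ups 𝒢 (h.toCenter z w) K ^ (rk M (K ∪ G) - rk M (⋃₀ ↑S ∪ G)) = 0 := by
  classical
  by_cases hl : ∀ H ∈ S, H ∈ link M 𝒢 G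
  · rw [h.ups_toCenter_of_not_subset hK hKG,
      Finset.prod_congr rfl fun H hH => h.toCenter_of_link (hl H hH)]
    have h1 := hw _ (h.join_sdiff_mem hK hKG) (S.image (· \ G)) (by
      simp only [Finset.mem_image, forall_exists_index, and_imp, forall_apply_eq_imp_iff₂]
      intro H hH
      refine ⟨h.contr_eq ▸ ⟨H, hl H hH, rfl⟩, ?_, fun h' => (hS H hH).2.2.2 ?_⟩
      · exact Set.sdiff_subset_sdiff_left ((hS H hH).2.2.1.trans
          (Set.subset_union_left.trans (h.subset_join hK)))
      · exact (h.subset_iff_of_link hK hKG (hl H hH)).2 h')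
    rw [Finset.prod_image fun H hH H' hH' => h.injOn_link (hl H hH) (hl H' hH'),
      rk_contract_sub] at h1
    have h2 : M.closure (K ∪ G) \ G ∪ G = M.closure (K ∪ G) := by
      rw [Set.sdiff_union_self, Set.union_eq_left]
      exact Set.subset_union_right.trans (h.subset_join hK)
    have h3 : ⋃₀ (↑(S.image (· \ G)) : Set (Set α)) ∪ G = ⋃₀ ↑S ∪ G := by
      ext e
      simp only [Finset.coe_image, Set.mem_union, Set.mem_sUnion, Set.mem_image,
        exists_exists_and_eq_and, Set.mem_sdiff]
      grind
    rwa [h2, rk_closure, h3] at h1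
  · push Not at hl
    obtain ⟨H, hH, hHl⟩ := hl
    rw [Finset.prod_eq_zero hH (h.toCenter_of_notMem_link (hS H hH).2.1 hHl), zero_mul]

lemma isExc_toCenter [M.Finite] (h : IsCenter M 𝒢 G)
    (hw : IsChow (M ／ G) (contr M 𝒢 G) w) : IsExc M 𝒢 G (h.toCenter z w) 1 := by
  intro K hK hGK S hS
  have := h.toCenter_rel_of_not_subset (z := z) hw hK hGK.2 hS
  rwa [Set.union_eq_left.2 hGK.1, ← one_mul (∏ H ∈ S, _)] at this

lemma rk_restrict_sub {X Y : Set α} (hX : X ⊆ G) (hY : Y ⊆ G) :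
    rk (M ↾ G) X - rk (M ↾ G) Y = rk M X - rk M Y := by
  rw [rk_restrict hX, rk_restrict hY]

lemma isChow_toCenter [M.Finite] (h : IsCenter M 𝒢 G)
    (hz : IsChow (M ↾ G) (restr 𝒢 G) z) (hw : IsChow (M ／ G) (contr M 𝒢 G) w) :
    IsChow M 𝒢 (h.toCenter z w) := by
  classical
  intro K hK S hS
  have hSK := sUnion_subset_of_ssubset fun H hH => (hS H hH).2
  by_cases hKG : K ⊆ G
  · rw [h.ups_toCenter_of_subset hK hKG, ← rk_restrict_sub hKG (hSK.trans hKG),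
      Finset.prod_congr rfl fun H hH => h.toCenter_of_subset ((hS H hH).2.1.trans hKG)
        fun h' => not_factor_ssubset h' hK (hS H hH).2 hKG]
    exact hz K ⟨hK, hKG⟩ S fun H hH => ⟨⟨(hS H hH).1, (hS H hH).2.1.trans hKG⟩, (hS H hH).2⟩
  · have h1 := h.toCenter_rel_of_not_subset (z := z) hw hK hKG
      (S := S.filter fun H => ¬ H ⊆ G) (by
        simp only [Finset.mem_filter]
        exact fun H hH => ⟨(hS H hH.1).1, hH.2, (hS H hH.1).2⟩)
    rw [sUnion_filter_union] at h1
    rw [← Finset.prod_filter_mul_prod_filter_not S (· ⊆ G), mul_assoc,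
      mul_pow_eq_zero_of_le h1 (rk_join_sub_le hSK), mul_zero]

end Restriction

section Extension

variable {x : Set α → R}

open scoped Classical in
/-- The variables of the Chow ring of the restriction to the center. -/
def ofRestr (_ : IsCenter M 𝒢 G) (x : Set α → R) (H : Set α) : R :=
  x H + if H ∈ factors (restr 𝒢 G) then ups 𝒢 x G else 0

/-- When `1` is exceptional the non-linked variables vanish, so the family is determined by its
parts on the restriction and the contraction. -/
lemma toCenter_of_isExc (h : IsCenter M 𝒢 G) (hx : IsExc M 𝒢 G x 1) {H : Set α} (hH : H ∈ 𝒢) :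
    h.toCenter (h.ofRestr x) (h.ofContr x) H = x H := by
  by_cases hHG : H ⊆ G
  · by_cases hHf : H ∈ factors (restr 𝒢 G)
    · rw [h.toCenter_of_mem_factors hHf, ofRestr, if_pos hHf,
        ups_congr fun K hK hGK => h.ofContr_sdiff (h.mem_link_of_subset hK hGK),
        add_sub_cancel_right]
    · rw [h.toCenter_of_subset hHG hHf, ofRestr, if_neg hHf, add_zero]
  · by_cases hl : H ∈ link M 𝒢 G
    · rw [h.toCenter_of_link hl, h.ofContr_sdiff hl]
    · rw [h.toCenter_of_notMem_link hHG hl, ← one_mul (x H),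
        h.mul_eq_zero_of_notMem_link hx hH hHG hl]

lemma isChow_ofRestr (h : IsCenter M 𝒢 G) (hc : IsChow M 𝒢 x) (hx : IsExc M 𝒢 G x 1) :
    IsChow (M ↾ G) (restr 𝒢 G) (h.ofRestr x) := by
  rintro K ⟨hK, hKG⟩ S hS
  have hSK := sUnion_subset_of_ssubset fun H hH => (hS H hH).2
  rw [rk_restrict_sub hKG (hSK.trans hKG), ← h.ups_toCenter_of_subset (w := h.ofContr x) hK hKG,
    ups_congr fun H hH _ => h.toCenter_of_isExc hx hH,
    Finset.prod_congr rfl fun H hH => ?_]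
  · exact hc K hK S fun H hH => ⟨(hS H hH).1.1, (hS H hH).2⟩
  · rw [ofRestr, if_neg fun h' => not_factor_ssubset h' hK (hS H hH).2 hKG, add_zero]

/-- Members of the contracted family lift to unique linked sets, where the relation is
`exc_of_isChow` at `t = 1`. -/
lemma isChow_ofContr [M.Finite] (h : IsCenter M 𝒢 G) (hc : IsChow M 𝒢 x)
    (hx : IsExc M 𝒢 G x 1) : IsChow (M ／ G) (contr M 𝒢 G) (h.ofContr x) := by
  classical
  intro X hX S hS
  rw [h.contr_eq] at hX
  obtain ⟨K, hK, rfl⟩ := hX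
  simp only at hS ⊢
  set φ := Function.invFunOn (· \ G) (link M 𝒢 G) with hφ
  have hS' : ∀ X ∈ S, φ X ∈ link M 𝒢 G ∧ φ X \ G = X := fun X hX => by
    have := (hS X hX).1
    rw [h.contr_eq] at this
    exact ⟨Function.invFunOn_mem this, Function.invFunOn_eq this⟩
  have hinj : Set.InjOn φ S := fun X hX Y hY he => by
    rw [← (hS' X hX).2, ← (hS' Y hY).2, he]
  have h1 := h.exc_of_isChow hx hc hK.1 hK.2.1 (S := S.image φ) (by
    simp only [Finset.mem_image, forall_exists_index, and_imp, forall_apply_eq_imp_iff₂]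
    intro X hX
    obtain ⟨h1, h2⟩ := hS' X hX
    obtain ⟨-, h3, h4⟩ := hS X hX
    rw [← h2] at h3 h4
    refine ⟨h1.1, h1.2.1, ?_, fun h' => h4 (Set.sdiff_subset_sdiff_left h')⟩
    rw [h.subset_iff_of_link h1.1 h1.2.1 hK, h.join_sdiff_of_link h1]
    exact h3)
  have h3 : ⋃₀ (↑(S.image φ) : Set (Set α)) ∪ G = ⋃₀ ↑S ∪ G := by
    have : (S : Set (Set α)) = (· \ G) '' ↑(S.image φ) := by
      rw [Finset.coe_image, Set.image_image]
      exact (Set.image_congr fun X hX => (hS' X hX).2).trans (Set.image_id' _) |>.symm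
    rw [this]
    ext e
    simp only [Set.mem_union, Set.mem_sUnion, Set.mem_image,
      exists_exists_and_eq_and, Set.mem_sdiff]
    grind
  rw [one_mul, Finset.prod_image hinj, h3] at h1
  rw [rk_contract_sub, Set.sdiff_union_self, ← h.join_sdiff_of_link hK,
    ← h.ups_toCenter_of_not_subset (z := h.ofRestr x) hK.1 hK.2.1,
    ups_congr fun H hH _ => h.toCenter_of_isExc hx hH]
  exact h1

end Extension

end IsCenter

end

/-! ### Universal property and grading of the Chow ring. -/

section

variable {α : Type*}

section ChowRing

variable {M : Matroid α} {𝒢 : Set (Set α)}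

variable (M 𝒢) in
open scoped Classical in
/-- The variables of the Chow ring, extended by zero to all sets. -/
def chowVar (H : Set α) : ChowRing M 𝒢 :=
  if hH : H ∈ 𝒢 then Ideal.Quotient.mk _ (MvPolynomial.X ⟨H, hH⟩) else 0

lemma chowVar_of_mem {H : Set α} (hH : H ∈ 𝒢) :
    chowVar M 𝒢 H = Ideal.Quotient.mk _ (MvPolynomial.X ⟨H, hH⟩) := dif_pos hH

lemma map_upSum {R : Type*} [CommRing R] (h𝒢 : 𝒢.Finite) (f : MvPolynomial 𝒢 ℚ →+* R)
    {x : Set α → R} (hx : ∀ H : 𝒢, f (MvPolynomial.X H) = x H) (K : 𝒢) :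
    f (upSum K) = ups 𝒢 x K := by
  have := h𝒢.to_subtype
  rw [upSum, ups]
  refine (f.toAddMonoidHom.map_finsum_mem _ (Set.toFinite _)).trans ?_
  refine finsum_mem_eq_of_bijOn Subtype.val ⟨?_, Subtype.val_injective.injOn, ?_⟩
    fun H _ => hx H
  · exact fun H hH => ⟨H.2, hH⟩
  · exact fun H hH => ⟨⟨H, hH.1⟩, hH.2, rfl⟩

open scoped Classical in
lemma rk_supBelow (S : Finset 𝒢) (K : 𝒢) :
    rk M (supBelow M S K) = rk M (⋃₀ (((S.filter fun H : 𝒢 => (H : Set α) ⊂ K).image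
      (Subtype.val : 𝒢 → Set α) : Finset (Set α)) : Set (Set α))) := by
  rw [supBelow, rk_closure]
  congr 1
  ext e
  simp

lemma isChow_chowVar (h𝒢 : 𝒢.Finite) : IsChow M 𝒢 (chowVar M 𝒢) := by
  classical
  intro K hK S hS
  have h1 : Ideal.Quotient.mk (chowIdeal M 𝒢) _ = 0 := Ideal.Quotient.eq_zero_iff_mem.2
    (Ideal.subset_span ⟨S.subtype (· ∈ 𝒢), ⟨K, hK⟩, rfl⟩)
  rw [rk_supBelow, map_mul, map_pow, map_prod, map_upSum h𝒢 _ (x := chowVar M 𝒢)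
    (fun H => (chowVar_of_mem H.2).symm)] at h1
  have h2 : ((S.subtype (· ∈ 𝒢)).filter fun H : 𝒢 => (H : Set α) ⊂ K).image
      (Subtype.val : 𝒢 → Set α) = S := by
    ext H
    simp only [Finset.mem_image, Finset.mem_filter, Finset.mem_subtype, Subtype.exists,
      exists_and_left, exists_prop, exists_eq_right_right]
    exact ⟨fun h => by tauto, fun h => by have := hS H h; tauto⟩
  rw [h2] at h1
  rw [← h1]
  congr 1
  rw [← Finset.prod_subtype_of_mem (p := (· ∈ 𝒢)) (chowVar M 𝒢) fun H hH => (hS H hH).1]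
  exact Finset.prod_congr rfl fun H _ => chowVar_of_mem H.2

variable {R : Type*} [CommRing R] [Algebra ℚ R]

/-- The universal property of the Chow ring. -/
def chowLift (h𝒢 : 𝒢.Finite) {x : Set α → R} (hx : IsChow M 𝒢 x) : ChowRing M 𝒢 →ₐ[ℚ] R :=
  Ideal.Quotient.liftₐ _ (MvPolynomial.aeval fun H : 𝒢 => x H) <| by
    classical
    suffices chowIdeal M 𝒢 ≤ RingHom.ker (MvPolynomial.aeval (R := ℚ) fun H : 𝒢 => x H) from
      fun a ha => RingHom.mem_ker.1 (this ha)
    refine Ideal.span_le.2 ?_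
    rintro _ ⟨S, K, rfl⟩
    simp only [SetLike.mem_coe, RingHom.mem_ker]
    rw [rk_supBelow, map_mul, map_pow, map_prod]
    have := map_upSum h𝒢 ((MvPolynomial.aeval (R := ℚ) fun H : 𝒢 => x H) : _ →+* R) (x := x)
      (by simp) K
    rw [RingHom.coe_coe] at this
    -- `IsChow` covers only sets strictly below `K`; other members of `S` leave the exponent
    -- unchanged and just contribute a factor.
    rw [this, ← Finset.prod_filter_mul_prod_filter_not S fun H => (H : Set α) ⊂ K]
    have h1 := hx K K.2 ((S.filter fun H : 𝒢 => (H : Set α) ⊂ K).image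
      (Subtype.val : 𝒢 → Set α)) (by
        simp only [Finset.mem_image, Finset.mem_filter]
        rintro _ ⟨H, ⟨-, hH⟩, rfl⟩
        exact ⟨H.2, hH⟩)
    rw [Finset.prod_image Subtype.val_injective.injOn] at h1
    simp only [MvPolynomial.aeval_X]
    rw [mul_right_comm, h1, zero_mul]

lemma chowLift_chowVar (h𝒢 : 𝒢.Finite) {x : Set α → R} (hx : IsChow M 𝒢 x) {H : Set α}
    (hH : H ∈ 𝒢) : chowLift h𝒢 hx (chowVar M 𝒢 H) = x H := by
  rw [chowVar_of_mem hH]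
  exact MvPolynomial.aeval_X (R := ℚ) (fun H : 𝒢 => x H) ⟨H, hH⟩

lemma chowRing_hom_ext {f g : ChowRing M 𝒢 →ₐ[ℚ] R}
    (h : ∀ H ∈ 𝒢, f (chowVar M 𝒢 H) = g (chowVar M 𝒢 H)) : f = g := by
  refine Ideal.Quotient.algHom_ext _ (MvPolynomial.algHom_ext fun H => ?_)
  have := h H H.2
  rwa [chowVar_of_mem H.2] at this

lemma chowRing_map_mem (S : Subalgebra ℚ R) (f : ChowRing M 𝒢 →ₐ[ℚ] R)
    (h : ∀ H ∈ 𝒢, f (chowVar M 𝒢 H) ∈ S) (a : ChowRing M 𝒢) : f a ∈ S := by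
  obtain ⟨p, rfl⟩ := Ideal.Quotient.mk_surjective a
  induction p using MvPolynomial.induction_on with
  | C r => exact (f.commutes r) ▸ S.algebraMap_mem r
  | add p q hp hq => rw [map_add, map_add]; exact S.add_mem hp hq
  | mul_X p H hp =>
    rw [map_mul, map_mul, ← chowVar_of_mem H.2]
    exact S.mul_mem hp (h H H.2)

end ChowRing

section Grading

variable {M : Matroid α} {𝒢 : Set (Set α)}

instance : SetLike.GradedMonoid (chowPiece M 𝒢) where
  one_mem := ⟨1, MvPolynomial.isHomogeneous_one _ _, map_one (Ideal.Quotient.mkₐ ℚ _)⟩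
  mul_mem := by
    rintro i j _ _ ⟨p, hp, rfl⟩ ⟨q, hq, rfl⟩
    exact ⟨p * q, MvPolynomial.IsHomogeneous.mul hp hq, map_mul (Ideal.Quotient.mkₐ ℚ _) p q⟩

lemma chowVar_mem (H : Set α) : chowVar M 𝒢 H ∈ chowPiece M 𝒢 1 := by
  by_cases hH : H ∈ 𝒢
  · rw [chowVar_of_mem hH]
    exact ⟨_, MvPolynomial.isHomogeneous_X _ _, rfl⟩
  · rw [chowVar, dif_neg hH]
    exact Submodule.zero_mem _

lemma iSup_chowPiece : ⨆ i, chowPiece M 𝒢 i = ⊤ := by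
  refine eq_top_iff.2 fun a _ => ?_
  obtain ⟨p, rfl⟩ := Ideal.Quotient.mk_surjective a
  rw [← MvPolynomial.sum_homogeneousComponent p, map_sum]
  refine Submodule.sum_mem _ fun i _ => Submodule.mem_iSup_of_mem i ?_
  exact ⟨_, MvPolynomial.homogeneousComponent_isHomogeneous _ _, rfl⟩

lemma upSum_isHomogeneous (K : 𝒢) : (upSum K).IsHomogeneous 1 := by
  rw [← MvPolynomial.mem_homogeneousSubmodule, upSum]
  refine finsum_mem_induction _ (Submodule.zero_mem _) (fun _ _ => Submodule.add_mem _)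
    fun H _ => MvPolynomial.isHomogeneous_X _ _

open MvPolynomial in
lemma homogeneousComponent_mem_chowIdeal {p : MvPolynomial 𝒢 ℚ} (hp : p ∈ chowIdeal M 𝒢) (n : ℕ) :
    MvPolynomial.homogeneousComponent n p ∈ chowIdeal M 𝒢 := by
  let _ := MvPolynomial.gradedAlgebra (σ := 𝒢) (R := ℚ)
  refine MvPolynomial.homogeneousComponent_mem_of_mem (Ideal.homogeneous_span _ _ ?_) hp n
  rintro _ ⟨S, K, rfl⟩
  refine ⟨∑ _ ∈ S, 1 + 1 * (rk M K - rk M (supBelow M S K)), ?_⟩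
  exact (MvPolynomial.IsHomogeneous.prod _ _ _ fun H _ => MvPolynomial.isHomogeneous_X _ _).mul
    ((upSum_isHomogeneous K).pow _)

/-- The ideal is homogeneous, so comparing degree-`n` components of two lifts separates the pieces.
-/
lemma iSupIndep_chowPiece : iSupIndep (chowPiece M 𝒢) := by
  intro n
  rw [Submodule.disjoint_def]
  rintro _ ⟨p, hp, rfl⟩ h
  simp only [chowPiece, ← Submodule.map_iSup] at h
  obtain ⟨q, hq, hqp⟩ := h
  have h1 : q ∈ LinearMap.ker (MvPolynomial.homogeneousComponent (σ := 𝒢) (R := ℚ) n) := by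
    have hle : ⨆ m, ⨆ (_ : m ≠ n), MvPolynomial.homogeneousSubmodule 𝒢 ℚ m ≤
        LinearMap.ker (MvPolynomial.homogeneousComponent (σ := 𝒢) (R := ℚ) n) := ?_
    · exact hle hq
    refine iSup₂_le fun m hm r hr => ?_
    rw [LinearMap.mem_ker, MvPolynomial.homogeneousComponent_of_mem hr, if_neg (Ne.symm hm)]
  have h2 : p - q ∈ chowIdeal M 𝒢 := by
    rw [← Ideal.Quotient.eq]; exact hqp.symm
  have h3 := homogeneousComponent_mem_chowIdeal h2 n
  rw [map_sub, LinearMap.mem_ker.1 h1, sub_zero, MvPolynomial.homogeneousComponent_of_mem hp,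
    if_pos rfl] at h3
  exact Ideal.Quotient.eq_zero_iff_mem.2 h3

lemma finite_chowPiece (h𝒢 : 𝒢.Finite) (n : ℕ) : Module.Finite ℚ (chowPiece M 𝒢 n) := by
  have := h𝒢.to_subtype
  exact Module.Finite.iff_fg.2 ((MvPolynomial.homogeneousSubmodule_fg _ _ n).map _)

/-- An algebra map out of the Chow ring which maps the variables into degree one preserves the
grading. -/
lemma map_chowPiece_le {R : Type*} [CommRing R] [Algebra ℚ R] (P : ℕ → Submodule ℚ R)
    [SetLike.GradedMonoid P] (f : ChowRing M 𝒢 →ₐ[ℚ] R) (h : ∀ H ∈ 𝒢, f (chowVar M 𝒢 H) ∈ P 1)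
    (n : ℕ) : (chowPiece M 𝒢 n).map f.toLinearMap ≤ P n := by
  rintro _ ⟨_, ⟨p, hp, rfl⟩, rfl⟩
  have hf : f.comp (Ideal.Quotient.mkₐ ℚ (chowIdeal M 𝒢)) =
      MvPolynomial.aeval fun H : 𝒢 => f (chowVar M 𝒢 H) := by
    refine MvPolynomial.algHom_ext fun H => ?_
    rw [MvPolynomial.aeval_X, chowVar_of_mem H.2]; rfl
  have : f (Ideal.Quotient.mk (chowIdeal M 𝒢) p) =
      MvPolynomial.aeval (fun H : 𝒢 => f (chowVar M 𝒢 H)) p := DFunLike.congr_fun hf p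
  change f (Ideal.Quotient.mk (chowIdeal M 𝒢) p) ∈ P n
  rw [this, MvPolynomial.aeval_def, MvPolynomial.eval₂_eq]
  refine Submodule.sum_mem _ fun d hd => ?_
  rw [← Algebra.smul_def]
  refine Submodule.smul_mem _ _ ?_
  have h1 := SetLike.prod_pow_mem_graded P (fun _ => 1) (fun H : 𝒢 => f (chowVar M 𝒢 H)) d
    (F := d.support) fun H _ => h H H.2
  have h2 : d.degree = n := by
    by_contra hne
    exact MvPolynomial.mem_support_iff.1 hd (MvPolynomial.IsHomogeneous.coeff_eq_zero hp hne)
  rw [← h2, Finsupp.degree_apply]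
  simpa using h1

end Grading

end

/-! ### Algebra of a quotient of `A[X]`, graded bases and degree series. -/

section

section BlowUpAlgebra

open Polynomial

variable {A B C : Type*} [CommRing A] [CommRing B] [CommRing C] [Algebra ℚ A] [Algebra ℚ B]
  [Algebra ℚ C]

/-- The map describing `B = A[t]` as the sum of `A` and of `m` copies of its quotient `C`. -/
def blowUpMap (φ : A →ₐ[ℚ] B) (t : B) (s : C →ₗ[ℚ] A) (m : ℕ) : A × (Fin m → C) →ₗ[ℚ] B :=
  φ.toLinearMap.coprod
    (∑ j : Fin m, (LinearMap.mulLeft ℚ (t ^ (j + 1 : ℕ))) ∘ₗ φ.toLinearMap ∘ₗ s ∘ₗ LinearMap.proj j)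

lemma blowUpMap_apply (φ : A →ₐ[ℚ] B) (t : B) (s : C →ₗ[ℚ] A) (m : ℕ) (a : A) (c : Fin m → C) :
    blowUpMap φ t s m (a, c) = φ a + ∑ j : Fin m, t ^ (j + 1 : ℕ) * φ (s (c j)) := by
  simp [blowUpMap]

variable {φ : A →ₐ[ℚ] B} {ψ : A →ₐ[ℚ] C} {t : B} {s : C →ₗ[ℚ] A} {m : ℕ} {P : A[X]}

/-- Reduce modulo the monic `P`. As `t` kills the image of `ker ψ`, the coefficient of a positive
power of `t` matters only through its image in `C`. -/
lemma blowUpMap_surjective (hs : ∀ c, ψ (s c) = c) (hP : P.Monic) (hm : P.natDegree = m + 1)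
    (hPt : P.eval₂ (φ : A →+* B) t = 0) (ht : ∀ a, ψ a = 0 → t * φ a = 0)
    (hsurj : ∀ b, ∃ q : A[X], q.eval₂ (φ : A →+* B) t = b) :
    Function.Surjective (blowUpMap φ t s m) := by
  intro b
  obtain ⟨q, rfl⟩ := hsurj b
  refine ⟨((q %ₘ P).coeff 0, fun j => ψ ((q %ₘ P).coeff (j + 1))), ?_⟩
  have h1 : q.eval₂ (φ : A →+* B) t = (q %ₘ P).eval₂ (φ : A →+* B) t := by
    conv_lhs => rw [← modByMonic_add_div q P]
    rw [eval₂_add, eval₂_mul, hPt, zero_mul, add_zero]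
  have h2 : (q %ₘ P).natDegree < m + 1 :=
    hm ▸ natDegree_modByMonic_lt q hP fun h => by simp [h] at hm
  rw [h1, eval₂_eq_sum_range' _ h2, blowUpMap_apply, Finset.sum_range_succ', pow_zero, mul_one,
    add_comm, Finset.sum_range]
  congr 1
  refine Finset.sum_congr rfl fun j _ => ?_
  have := ht (s (ψ ((q %ₘ P).coeff (j + 1))) - (q %ₘ P).coeff (j + 1)) (by
    rw [map_sub, hs, sub_self])
  rw [map_sub, mul_sub, sub_eq_zero] at this
  rw [pow_succ, mul_assoc, this, RingHom.coe_coe]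
  ring

/-- In `C[X]` a relation becomes a multiple of the monic image of `P` of smaller degree, so it
vanishes there, as does its cofactor `f`. What remains is the constant coefficient `P(0) f(0)`,
killed by `hP0` since `ψ (f(0)) = 0`. -/
lemma blowUpMap_injective (hs : ∀ c, ψ (s c) = c) (hP : P.Monic) (hm : P.natDegree = m + 1)
    (hP0 : ∀ a, ψ a = 0 → P.coeff 0 * a = 0)
    (hker : ∀ q : A[X], q.eval₂ (φ : A →+* B) t = 0 →
      ∃ f g : A[X], g.map (ψ : A →+* C) = 0 ∧ q = P * f + X * g) :
    Function.Injective (blowUpMap φ t s m) := by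
  rw [injective_iff_map_eq_zero]
  rintro ⟨a, c⟩ h
  rw [blowUpMap_apply] at h
  obtain ⟨f, g, hg, hq⟩ := hker (Polynomial.C a + ∑ j : Fin m, X ^ (j + 1 : ℕ) *
    Polynomial.C (s (c j))) (by
      rw [eval₂_add, eval₂_C, eval₂_finsetSum]
      simpa only [eval₂_mul, eval₂_C, eval₂_X_pow, RingHom.coe_coe] using h)
  set r : C[X] := Polynomial.C (ψ a) + ∑ j : Fin m, X ^ (j + 1 : ℕ) * Polynomial.C (c j) with hr
  have h1 : r = P.map (ψ : A →+* C) * f.map (ψ : A →+* C) := by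
    have := congrArg (Polynomial.map (ψ : A →+* C)) hq
    rw [Polynomial.map_add, Polynomial.map_sum, Polynomial.map_add, Polynomial.map_mul,
      Polynomial.map_mul, hg, mul_zero, add_zero] at this
    rw [← this, hr]
    simp [hs]
  obtain ⟨hf, rfl⟩ : f.map (ψ : A →+* C) = 0 ∧ c = 0 := by
    rcases subsingleton_or_nontrivial C with hC | hC
    · exact ⟨Subsingleton.elim _ _, Subsingleton.elim _ _⟩
    have : Nontrivial A := (ψ : A →+* C).domain_nontrivial
    have hPm := hP.map (ψ : A →+* C)
    have hdeg : r.degree < (P.map (ψ : A →+* C)).degree := by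
      rw [hP.degree_map, degree_eq_natDegree hP.ne_zero, hm]
      refine (degree_add_le _ _).trans_lt (max_lt (degree_C_le.trans_lt (by simp; positivity)) ?_)
      refine (degree_sum_le _ _).trans_lt ((Finset.sup_lt_iff (by simp)).2 fun j _ => ?_)
      rw [mul_comm]
      refine (degree_C_mul_X_pow_le _ _).trans_lt ?_
      exact_mod_cast Nat.add_lt_add_right j.2 1
    have hr0 : r = 0 := by
      by_contra hne
      exact hPm.not_dvd_of_degree_lt hne hdeg ⟨_, h1⟩
    refine ⟨(hPm.mul_right_eq_zero_iff).1 (hr0 ▸ h1).symm, ?_⟩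
    · funext j
      have := congrArg (Polynomial.coeff · (j + 1 : ℕ)) hr0
      simp only [hr, coeff_add, finsetSum_coeff, coeff_mul_C, coeff_X_pow, coeff_C,
        coeff_zero] at this
      rw [Finset.sum_eq_single j] at this
      · simpa using this
      · intro i _ hij
        rw [if_neg, zero_mul]
        intro h
        exact hij (Fin.ext (by omega))
      · simp
  have ha := congrArg (Polynomial.coeff · 0) hq
  have hf0 : ψ (f.coeff 0) = 0 := by
    have := congrArg (Polynomial.coeff · 0) hf
    simpa using this
  simp [mul_coeff_zero, hP0 _ hf0] at ha
  simp [ha]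

end BlowUpAlgebra

section Graded

/-- A basis adapted to a grading. -/
def IsGradedBasis {V ι : Type*} [AddCommGroup V] [Module ℚ V] (P : ℕ → Submodule ℚ V)
    (b : Module.Basis ι ℚ V) (d : ι → ℕ) : Prop :=
  ∀ n, P n = Submodule.span ℚ (b '' {i | d i = n})

universe v

variable {V : Type v} [AddCommGroup V] [Module ℚ V]

lemma exists_isGradedBasis {P : ℕ → Submodule ℚ V} (h1 : iSupIndep P) (h2 : ⨆ n, P n = ⊤) :
    ∃ (ι : Type v) (b : Module.Basis ι ℚ V) (d : ι → ℕ), IsGradedBasis P b d := by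
  classical
  have hI := DirectSum.isInternal_submodule_of_iSupIndep_of_iSup_eq_top h1 h2
  refine ⟨_, hI.collectedBasis fun n => Module.Basis.ofVectorSpace ℚ (P n), Sigma.fst, fun n => ?_⟩
  have h3 := congrArg (Submodule.map (P n).subtype) (Module.Basis.ofVectorSpace ℚ (P n)).span_eq
  rw [Submodule.map_span, Submodule.map_top, Submodule.range_subtype, ← Set.range_comp] at h3
  rw [← h3]
  congr 1
  ext v
  simp only [Set.mem_range, Set.mem_image, DirectSum.IsInternal.collectedBasis_coe]
  constructor
  · rintro ⟨i, rfl⟩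
    exact ⟨⟨n, i⟩, rfl, rfl⟩
  · rintro ⟨⟨_, i⟩, rfl, rfl⟩
    exact ⟨i, rfl⟩

lemma IsGradedBasis.mem {P : ℕ → Submodule ℚ V} {ι : Type*} {b : Module.Basis ι ℚ V} {d : ι → ℕ}
    (h : IsGradedBasis P b d) (i : ι) : b i ∈ P (d i) := by
  rw [h]; exact Submodule.subset_span ⟨i, rfl, rfl⟩

lemma IsGradedBasis.finrank_eq {P : ℕ → Submodule ℚ V} {ι : Type*} {b : Module.Basis ι ℚ V}
    {d : ι → ℕ} (h : IsGradedBasis P b d) (n : ℕ) :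
    Module.finrank ℚ (P n) = Nat.card {i // d i = n} := by
  have hli : LinearIndependent ℚ fun i : {i // d i = n} => b i :=
    b.linearIndependent.comp _ Subtype.val_injective
  have hr : Set.range (fun i : {i // d i = n} => b i) = b '' {i | d i = n} := by
    ext v; simp
  rw [h n, ← hr, Module.finrank_eq_nat_card_basis (Module.Basis.span hli)]

lemma IsGradedBasis.finite {P : ℕ → Submodule ℚ V} {ι : Type*} {b : Module.Basis ι ℚ V}
    {d : ι → ℕ} (h : IsGradedBasis P b d) (n : ℕ) [Module.Finite ℚ (P n)] :
    Finite {i // d i = n} := by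
  have hli : LinearIndependent ℚ fun i : {i // d i = n} => (⟨b i, by
      have := h.mem i; rwa [i.2] at this⟩ : P n) := by
    refine LinearIndependent.of_comp (P n).subtype ?_
    exact b.linearIndependent.comp _ Subtype.val_injective
  exact hli.finite

/-- The part of `v ∈ Q n` outside `P n` lies in `Q n` and in the sum of the other pieces, so it is
zero. This makes an ungraded surjection or basis a graded one. -/
lemma eq_of_le_of_iSup_eq_top {P Q : ℕ → Submodule ℚ V} (hPQ : ∀ n, P n ≤ Q n)
    (hQ : iSupIndep Q) (hP : ⨆ n, P n = ⊤) : P = Q := by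
  funext n
  refine le_antisymm (hPQ n) fun v hv => ?_
  have hv' : v ∈ P n ⊔ ⨆ k, ⨆ (_ : k ≠ n), P k := by
    rw [← iSup_split_single, hP]
    exact Submodule.mem_top
  obtain ⟨u, hu, w, hw, rfl⟩ := Submodule.mem_sup.1 hv'
  have h1 : w ∈ Q n := by
    have := Submodule.sub_mem _ hv (hPQ n hu)
    rwa [add_sub_cancel_left] at this
  have h2 : w ∈ ⨆ k, ⨆ (_ : k ≠ n), Q k := iSup₂_mono (fun k _ => hPQ k) hw
  rw [(Submodule.disjoint_def.1 (hQ n)) w h1 h2, add_zero]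
  exact hu

lemma iSup_span_basis {ι : Type*} (b : Module.Basis ι ℚ V) (d : ι → ℕ) :
    ⨆ n, Submodule.span ℚ (b '' {i | d i = n}) = ⊤ := by
  rw [← Submodule.span_iUnion, ← b.span_eq]
  congr 1
  ext v
  simp

/-- A basis whose members are homogeneous is adapted to the grading. -/
lemma isGradedBasis_of_mem {P : ℕ → Submodule ℚ V} (hP : iSupIndep P) {ι : Type*}
    (b : Module.Basis ι ℚ V) (d : ι → ℕ) (h : ∀ i, b i ∈ P (d i)) : IsGradedBasis P b d := by
  intro n
  refine (congrFun (eq_of_le_of_iSup_eq_top (fun n => ?_) hP (iSup_span_basis b d)) n).symm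
  rw [Submodule.span_le]
  rintro _ ⟨i, rfl, rfl⟩
  exact h i

lemma iSupIndep_span_basis {ι : Type*} (b : Module.Basis ι ℚ V) (d : ι → ℕ) :
    iSupIndep fun n => Submodule.span ℚ (b '' {i | d i = n}) := by
  intro n
  have : (⨆ k, ⨆ (_ : k ≠ n), Submodule.span ℚ (b '' {i | d i = k})) =
      Submodule.span ℚ (b '' {i | d i ≠ n}) := by
    simp_rw [← Submodule.span_iUnion]
    congr 1
    ext v
    simp
  rw [this]
  refine b.linearIndependent.disjoint_span_image ?_
  exact Set.disjoint_left.2 fun i hi hi' => hi' hi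

end Graded

section Series

/-- The generating function of the degrees. -/
def degSeries {ι : Type*} (d : ι → ℕ) : ℤ⟦X⟧ :=
  PowerSeries.mk fun n => (Nat.card {i // d i = n} : ℤ)

lemma degSeries_sum {ι κ : Type*} (d : ι → ℕ) (e : κ → ℕ) (hd : ∀ n, Finite {i // d i = n})
    (he : ∀ n, Finite {i // e i = n}) :
    degSeries (Sum.elim d e) = degSeries d + degSeries e := by
  ext n
  rw [map_add, degSeries, degSeries, degSeries, PowerSeries.coeff_mk, PowerSeries.coeff_mk,
    PowerSeries.coeff_mk, ← Nat.cast_add, ← Nat.card_sum]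
  congr 1
  exact Nat.card_congr
    { toFun := fun i => match i with
        | ⟨Sum.inl i, h⟩ => Sum.inl ⟨i, h⟩
        | ⟨Sum.inr i, h⟩ => Sum.inr ⟨i, h⟩
      invFun := fun i => match i with
        | Sum.inl i => ⟨Sum.inl i.1, i.2⟩
        | Sum.inr i => ⟨Sum.inr i.1, i.2⟩
      left_inv := by rintro ⟨i | i, h⟩ <;> rfl
      right_inv := by rintro (i | i) <;> rfl }

/-- Pairs of total degree `n`, sorted by the degrees of their members. -/
def degProdEquiv {ι κ : Type*} (d : ι → ℕ) (e : κ → ℕ) (n : ℕ) :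
    {p : ι × κ // d p.1 + e p.2 = n} ≃
      Σ q : Finset.HasAntidiagonal.antidiagonal n, {i // d i = q.1.1} × {i // e i = q.1.2} where
  toFun p := ⟨⟨(d p.1.1, e p.1.2), Finset.HasAntidiagonal.mem_antidiagonal.2 p.2⟩,
    ⟨p.1.1, rfl⟩, ⟨p.1.2, rfl⟩⟩
  invFun q := ⟨(q.2.1.1, q.2.2.1), by
    rw [q.2.1.2, q.2.2.2]; exact Finset.HasAntidiagonal.mem_antidiagonal.1 q.1.2⟩
  left_inv _ := rfl
  right_inv := by
    rintro ⟨⟨⟨a, b⟩, h⟩, ⟨i, hi⟩, ⟨j, hj⟩⟩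
    change d i = a at hi
    change e j = b at hj
    subst hi hj
    rfl

lemma finite_degProd {ι κ : Type*} (d : ι → ℕ) (e : κ → ℕ) (hd : ∀ n, Finite {i // d i = n})
    (he : ∀ n, Finite {i // e i = n}) (n : ℕ) : Finite {p : ι × κ // d p.1 + e p.2 = n} :=
  Finite.of_equiv _ (degProdEquiv d e n).symm

lemma degSeries_prod {ι κ : Type*} (d : ι → ℕ) (e : κ → ℕ) (hd : ∀ n, Finite {i // d i = n})
    (he : ∀ n, Finite {i // e i = n}) :
    degSeries (fun p : ι × κ => d p.1 + e p.2) = degSeries d * degSeries e := by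
  ext n
  rw [PowerSeries.coeff_mul]
  simp only [degSeries, PowerSeries.coeff_mk]
  rw [Nat.card_congr (degProdEquiv d e n), Nat.card_sigma,
    Finset.sum_coe_sort _ fun q : ℕ × ℕ => Nat.card ({i // d i = q.1} × {i // e i = q.2})]
  simp [Nat.card_prod]

lemma degSeries_fin (m : ℕ) :
    degSeries (fun j : Fin m => (j : ℕ) + 1) =
      ∑ i ∈ Finset.Ico 1 (m + 1), (PowerSeries.X : ℤ⟦X⟧) ^ i := by
  ext n
  rw [map_sum]
  simp only [degSeries, PowerSeries.coeff_mk, PowerSeries.coeff_X_pow]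
  rw [Finset.sum_ite_eq (Finset.Ico 1 (m + 1)) n fun _ => (1 : ℤ)]
  split_ifs with h
  · rw [Finset.mem_Ico] at h
    have : Unique {j : Fin m // (j : ℕ) + 1 = n} :=
      { default := ⟨⟨n - 1, by omega⟩, by simp; omega⟩
        uniq := by rintro ⟨j, hj⟩; ext; simp; omega }
    simp
  · have : IsEmpty {j : Fin m // (j : ℕ) + 1 = n} := by
      refine ⟨fun j => h (Finset.mem_Ico.2 ?_)⟩
      have := j.2; have := j.1.2; omega
    simp

end Series

end

/-! ### Tensor products as graded coproducts. -/

section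

universe u

section Tensor

open scoped TensorProduct

variable {D E : Type u} [CommRing D] [CommRing E] [Algebra ℚ D] [Algebra ℚ E]

/-- The commutative algebra `C` is the coproduct of `D` and `E`. -/
structure IsCoproduct {C : Type u} [CommRing C] [Algebra ℚ C] (l : D →ₐ[ℚ] C) (r : E →ₐ[ℚ] C) :
    Prop where
  sup_range : l.range ⊔ r.range = ⊤
  exists_lift : ∀ {R : Type u} [CommRing R] [Algebra ℚ R] (f : D →ₐ[ℚ] R) (g : E →ₐ[ℚ] R),
    ∃ θ : C →ₐ[ℚ] R, (∀ x, θ (l x) = f x) ∧ ∀ y, θ (r y) = g y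

variable (D E) in
lemma isCoproduct_tensor : IsCoproduct (Algebra.TensorProduct.includeLeft : D →ₐ[ℚ] D ⊗[ℚ] E)
    (Algebra.TensorProduct.includeRight : E →ₐ[ℚ] D ⊗[ℚ] E) where
  sup_range := by
    refine eq_top_iff.2 fun c _ => ?_
    induction c using TensorProduct.induction_on with
    | zero => exact zero_mem _
    | add a b ha hb => exact add_mem (ha trivial) (hb trivial)
    | tmul a b =>
      have h1 : (Algebra.TensorProduct.includeLeft : D →ₐ[ℚ] D ⊗[ℚ] E) a ∈
        (Algebra.TensorProduct.includeLeft : D →ₐ[ℚ] D ⊗[ℚ] E).range ⊔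
          (Algebra.TensorProduct.includeRight : E →ₐ[ℚ] D ⊗[ℚ] E).range :=
        le_sup_left (a := AlgHom.range _) ⟨a, rfl⟩
      have h2 : (Algebra.TensorProduct.includeRight : E →ₐ[ℚ] D ⊗[ℚ] E) b ∈
        (Algebra.TensorProduct.includeLeft : D →ₐ[ℚ] D ⊗[ℚ] E).range ⊔
          (Algebra.TensorProduct.includeRight : E →ₐ[ℚ] D ⊗[ℚ] E).range :=
        le_sup_right (b := AlgHom.range _) ⟨b, rfl⟩
      have := mul_mem h1 h2
      rwa [Algebra.TensorProduct.includeLeft_apply, Algebra.TensorProduct.includeRight_apply,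
        Algebra.TensorProduct.tmul_mul_tmul, mul_one, one_mul] at this
  exists_lift f g := ⟨Algebra.TensorProduct.productMap f g,
    Algebra.TensorProduct.productMap_left_apply f g,
    Algebra.TensorProduct.productMap_right_apply f g⟩

variable {ι κ : Type*} (b : Module.Basis ι ℚ D) (d : ι → ℕ) (c : Module.Basis κ ℚ E) (e : κ → ℕ)

/-- The grading of a tensor product. -/
def tensorPiece (n : ℕ) : Submodule ℚ (D ⊗[ℚ] E) :=
  Submodule.span ℚ (b.tensorProduct c '' {p | d p.1 + e p.2 = n})

variable {b d c e} {P : ℕ → Submodule ℚ D} {Q : ℕ → Submodule ℚ E}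

lemma tmul_mem_tensorPiece (hb : IsGradedBasis P b d) (hc : IsGradedBasis Q c e) {m n : ℕ}
    {x : D} {y : E} (hx : x ∈ P m) (hy : y ∈ Q n) : x ⊗ₜ y ∈ tensorPiece b d c e (m + n) := by
  rw [hb] at hx
  rw [hc] at hy
  induction hx using Submodule.span_induction with
  | zero => rw [TensorProduct.zero_tmul]; exact Submodule.zero_mem _
  | add u v _ _ hu hv => rw [TensorProduct.add_tmul]; exact Submodule.add_mem _ hu hv
  | smul r u _ hu => rw [← TensorProduct.smul_tmul']; exact Submodule.smul_mem _ _ hu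
  | mem u hu =>
    obtain ⟨i, rfl, rfl⟩ := hu
    induction hy using Submodule.span_induction with
    | zero => rw [TensorProduct.tmul_zero]; exact Submodule.zero_mem _
    | add u v _ _ hu hv => rw [TensorProduct.tmul_add]; exact Submodule.add_mem _ hu hv
    | smul r u _ hu => rw [TensorProduct.tmul_smul]; exact Submodule.smul_mem _ _ hu
    | mem u hu =>
      obtain ⟨j, rfl, rfl⟩ := hu
      exact Submodule.subset_span ⟨(i, j), rfl, b.tensorProduct_apply c i j⟩

lemma mul_mem_tensorPiece [SetLike.GradedMonoid P] [SetLike.GradedMonoid Q]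
    (hb : IsGradedBasis P b d) (hc : IsGradedBasis Q c e) {m n : ℕ} {x y : D ⊗[ℚ] E}
    (hx : x ∈ tensorPiece b d c e m) (hy : y ∈ tensorPiece b d c e n) :
    x * y ∈ tensorPiece b d c e (m + n) := by
  unfold tensorPiece at hx hy
  induction hx using Submodule.span_induction with
  | zero => rw [zero_mul]; exact Submodule.zero_mem _
  | add u v _ _ hu hv => rw [add_mul]; exact Submodule.add_mem _ hu hv
  | smul r u _ hu => rw [smul_mul_assoc]; exact Submodule.smul_mem _ _ hu
  | mem u hu =>
    obtain ⟨⟨i, j⟩, rfl, rfl⟩ := hu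
    induction hy using Submodule.span_induction with
    | zero => rw [mul_zero]; exact Submodule.zero_mem _
    | add u v _ _ hu hv => rw [mul_add]; exact Submodule.add_mem _ hu hv
    | smul r u _ hu => rw [mul_smul_comm]; exact Submodule.smul_mem _ _ hu
    | mem u hu =>
      obtain ⟨⟨k, l⟩, rfl, rfl⟩ := hu
      rw [b.tensorProduct_apply, b.tensorProduct_apply, Algebra.TensorProduct.tmul_mul_tmul,
        add_add_add_comm]
      exact tmul_mem_tensorPiece hb hc (SetLike.mul_mem_graded (hb.mem i) (hb.mem k))
        (SetLike.mul_mem_graded (hc.mem j) (hc.mem l))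

/-- The coproduct of two graded algebras with adapted bases is graded by the total degree. -/
lemma exists_isCoproduct [SetLike.GradedMonoid P] [SetLike.GradedMonoid Q]
    (hb : IsGradedBasis P b d) (hc : IsGradedBasis Q c e) :
    ∃ (C : Type u) (_ : CommRing C) (_ : Algebra ℚ C) (l : D →ₐ[ℚ] C) (r : E →ₐ[ℚ] C)
      (N : ℕ → Submodule ℚ C) (v : Module.Basis (ι × κ) ℚ C),
      IsCoproduct l r ∧ SetLike.GradedMonoid N ∧
        IsGradedBasis N v (fun p => d p.1 + e p.2) ∧ iSupIndep N ∧ (∀ x ∈ P 1, l x ∈ N 1) ∧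
          ∀ y ∈ Q 1, r y ∈ N 1 := by
  have h1 : (1 : D ⊗[ℚ] E) ∈ tensorPiece b d c e 0 :=
    tmul_mem_tensorPiece hb hc (m := 0) (n := 0) (SetLike.one_mem_graded P)
      (SetLike.one_mem_graded Q)
  refine ⟨D ⊗[ℚ] E, inferInstance, inferInstance, Algebra.TensorProduct.includeLeft,
    Algebra.TensorProduct.includeRight, tensorPiece b d c e, b.tensorProduct c,
    isCoproduct_tensor D E,
    { one_mem := h1, mul_mem := fun _ _ _ _ hx hy => mul_mem_tensorPiece hb hc hx hy },
    fun n => rfl, iSupIndep_span_basis _ _, fun x hx => ?_, fun y hy => ?_⟩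
  · exact tmul_mem_tensorPiece hb hc (m := 1) (n := 0) hx (SetLike.one_mem_graded Q)
  · exact tmul_mem_tensorPiece hb hc (m := 0) (n := 1) (SetLike.one_mem_graded P) hy

end Tensor

end

/-! ### The restriction homomorphism to the center and its kernel. -/

section

universe u

lemma ups_mem {α : Type*} {R : Type*} [CommRing R] [Algebra ℚ R] (N : Submodule ℚ R)
    {𝒢 : Set (Set α)} {x : Set α → R} {K : Set α} (hx : ∀ H ∈ 𝒢, K ⊆ H → x H ∈ N) :
    ups 𝒢 x K ∈ N :=
  finsum_mem_induction (· ∈ N) N.zero_mem (fun _ _ => N.add_mem) fun H hH => hx H hH.1 hH.2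

namespace IsCenter

variable {α : Type u} {M : Matroid α} {𝒢 : Set (Set α)} {G : Set α}

lemma map_toCenter {R R' : Type*} [CommRing R] [CommRing R'] (h : IsCenter M 𝒢 G)
    (f : R →+* R') (z w : Set α → R) (H : Set α) :
    f (h.toCenter z w H) = h.toCenter (fun K => f (z K)) (fun K => f (w K)) H := by
  rw [toCenter, toCenter, map_add, map_sub, apply_ite f, apply_ite f, apply_ite f, map_zero,
    map_ups h.finite]

lemma toCenter_congr {R : Type*} [CommRing R] (h : IsCenter M 𝒢 G)
    {z z' w w' : Set α → R} (hz : ∀ H ∈ restr 𝒢 G, z H = z' H)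
    (hw : ∀ X ∈ contr M 𝒢 G, w X = w' X) {H : Set α} (hH : H ∈ 𝒢) :
    h.toCenter z w H = h.toCenter z' w' H := by
  have hl : ∀ K ∈ link M 𝒢 G, w (K \ G) = w' (K \ G) := fun K hK =>
    hw _ (h.contr_eq ▸ ⟨K, hK, rfl⟩)
  have h1 : ups 𝒢 (fun K => w (K \ G)) G = ups 𝒢 (fun K => w' (K \ G)) G :=
    ups_congr fun K hK hGK => hl K (h.mem_link_of_subset hK hGK)
  by_cases hHG : H ⊆ G
  · by_cases hf : H ∈ factors (restr 𝒢 G)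
    · rw [h.toCenter_of_mem_factors hf, h.toCenter_of_mem_factors hf, h1, hz H ⟨hH, hHG⟩]
    · rw [h.toCenter_of_subset hHG hf, h.toCenter_of_subset hHG hf, hz H ⟨hH, hHG⟩]
  · by_cases hHl : H ∈ link M 𝒢 G
    · rw [h.toCenter_of_link hHl, h.toCenter_of_link hHl, hl H hHl]
    · rw [h.toCenter_of_notMem_link hHG hHl, h.toCenter_of_notMem_link hHG hHl]

lemma toCenter_mem {R : Type*} [CommRing R] [Algebra ℚ R] (h : IsCenter M 𝒢 G)
    (N : Submodule ℚ R) {z w : Set α → R} (hz : ∀ H, z H ∈ N) (hw : ∀ X, w X ∈ N) (H : Set α) :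
    h.toCenter z w H ∈ N := by
  have h1 : ups 𝒢 (fun K => w (K \ G)) G ∈ N := ups_mem N fun K _ _ => hw _
  unfold toCenter
  refine N.add_mem (N.sub_mem ?_ ?_) ?_ <;> split_ifs <;>
    first | exact N.zero_mem | exact hz _ | exact hw _ | exact h1

variable {C : Type u} [CommRing C] [Algebra ℚ C] {l : ChowRing (M ↾ G) (restr 𝒢 G) →ₐ[ℚ] C}
  {r : ChowRing (M ／ G) (contr M 𝒢 G) →ₐ[ℚ] C}

/-- The variables of the Chow ring after restriction to the center. -/
def centerVar (h : IsCenter M 𝒢 G) (l : ChowRing (M ↾ G) (restr 𝒢 G) →ₐ[ℚ] C)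
    (r : ChowRing (M ／ G) (contr M 𝒢 G) →ₐ[ℚ] C) : Set α → C :=
  h.toCenter (fun H => l (chowVar _ _ H)) (fun X => r (chowVar _ _ X))

lemma isChow_contr (h : IsCenter M 𝒢 G) (r : ChowRing (M ／ G) (contr M 𝒢 G) →ₐ[ℚ] C) :
    IsChow (M ／ G) (contr M 𝒢 G) (fun X => r (chowVar _ _ X)) :=
  (isChow_chowVar h.finite_contr).map h.finite_contr r.toRingHom

lemma isChow_centerVar [M.Finite] (h : IsCenter M 𝒢 G)
    (l : ChowRing (M ↾ G) (restr 𝒢 G) →ₐ[ℚ] C) (r : ChowRing (M ／ G) (contr M 𝒢 G) →ₐ[ℚ] C) :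
    IsChow M 𝒢 (h.centerVar l r) :=
  h.isChow_toCenter ((isChow_chowVar (finite_restr h.finite G)).map (finite_restr h.finite G)
    l.toRingHom) (h.isChow_contr r)

/-- The restriction of the Chow ring to the center of the blow-up. -/
def toCenterHom [M.Finite] (h : IsCenter M 𝒢 G) (l : ChowRing (M ↾ G) (restr 𝒢 G) →ₐ[ℚ] C)
    (r : ChowRing (M ／ G) (contr M 𝒢 G) →ₐ[ℚ] C) : ChowRing M 𝒢 →ₐ[ℚ] C :=
  chowLift h.finite (h.isChow_centerVar l r)

variable [M.Finite]

lemma toCenterHom_chowVar (h : IsCenter M 𝒢 G) {H : Set α} (hH : H ∈ 𝒢) :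
    h.toCenterHom l r (chowVar M 𝒢 H) = h.centerVar l r H :=
  chowLift_chowVar _ _ hH

lemma contr_mem_range (h : IsCenter M 𝒢 G) {X : Set α} (hX : X ∈ contr M 𝒢 G) :
    r (chowVar _ _ X) ∈ (h.toCenterHom l r).range := by
  have hX' := hX
  rw [h.contr_eq] at hX'
  obtain ⟨H, hH, rfl⟩ := hX'
  exact ⟨chowVar M 𝒢 H, (h.toCenterHom_chowVar hH.1).trans (h.toCenter_of_link hH)⟩

/-- The image of a factor variable is off by a sum of contraction variables, which are already in
the range. -/
lemma restr_mem_range (h : IsCenter M 𝒢 G) {H : Set α} (hH : H ∈ restr 𝒢 G) :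
    l (chowVar _ _ H) ∈ (h.toCenterHom l r).range := by
  have h1 : h.toCenterHom l r (chowVar M 𝒢 H) ∈ (h.toCenterHom l r).range := ⟨_, rfl⟩
  rw [h.toCenterHom_chowVar hH.1, centerVar] at h1
  by_cases hf : H ∈ factors (restr 𝒢 G)
  · rw [h.toCenter_of_mem_factors hf] at h1
    have h2 : ups 𝒢 (fun K => r (chowVar _ _ (K \ G))) G ∈
        Subalgebra.toSubmodule (h.toCenterHom l r).range := by
      refine ups_mem _ fun K hK hGK => h.contr_mem_range ?_
      rw [h.contr_eq]
      exact ⟨K, h.mem_link_of_subset hK hGK, rfl⟩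
    have := add_mem h1 h2
    rwa [sub_add_cancel] at this
  · rwa [h.toCenter_of_subset hH.2 hf] at h1

lemma toCenterHom_surjective (h : IsCenter M 𝒢 G) (hC : IsCoproduct l r) :
    Function.Surjective (h.toCenterHom l r) := by
  rw [← AlgHom.range_eq_top, eq_top_iff, ← hC.sup_range]
  refine sup_le ?_ ?_
  · rintro _ ⟨a, rfl⟩
    exact chowRing_map_mem _ l (fun H hH => h.restr_mem_range hH) a
  · rintro _ ⟨a, rfl⟩
    exact chowRing_map_mem _ r (fun H hH => h.contr_mem_range hH) a

/-- The kernel of the restriction to the center is annihilated by every exceptional element. -/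
lemma mul_eq_zero_of_toCenterHom_eq_zero {R : Type u} [CommRing R] [Algebra ℚ R]
    (h : IsCenter M 𝒢 G) (hC : IsCoproduct l r) (f : ChowRing M 𝒢 →ₐ[ℚ] R) {t : R}
    (ht : IsExc M 𝒢 G (fun H => f (chowVar M 𝒢 H)) t) {a : ChowRing M 𝒢}
    (ha : h.toCenterHom l r a = 0) : t * f a = 0 := by
  -- `I` is the annihilator of `t`. In `R ⧸ I` the element `1` is exceptional, so `f` modulo `I`
  -- factors through `C` and kills `a`.
  let I : Ideal R := LinearMap.ker (LinearMap.toSpanSingleton R R t)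
  have hI : ∀ y, y ∈ I ↔ t * y = 0 := fun y => by
    rw [LinearMap.mem_ker, LinearMap.toSpanSingleton_apply, smul_eq_mul, mul_comm]
  let g : ChowRing M 𝒢 →ₐ[ℚ] R ⧸ I := (Ideal.Quotient.mkₐ ℚ I).comp f
  have hc : IsChow M 𝒢 fun H => g (chowVar M 𝒢 H) :=
    (isChow_chowVar h.finite).map h.finite g.toRingHom
  have hx : IsExc M 𝒢 G (fun H => g (chowVar M 𝒢 H)) 1 := by
    intro K hK hGK S hS
    have h1 := (hI _).2 ((mul_assoc _ _ _).symm.trans (ht K hK hGK S hS))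
    have h2 := Ideal.Quotient.eq_zero_iff_mem.2 h1
    rw [map_mul, map_prod, map_pow, map_ups h.finite] at h2
    rw [one_mul]
    exact h2
  obtain ⟨θ, hl, hr⟩ := hC.exists_lift
    (chowLift (finite_restr h.finite G) (h.isChow_ofRestr hc hx))
    (chowLift h.finite_contr (h.isChow_ofContr hc hx))
  have hθ : θ.comp (h.toCenterHom l r) = g := by
    refine chowRing_hom_ext fun H hH => ?_
    rw [AlgHom.comp_apply, h.toCenterHom_chowVar hH]
    refine (h.map_toCenter θ.toRingHom _ _ H).trans ?_
    rw [← h.toCenter_of_isExc hx hH]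
    refine h.toCenter_congr (fun K hK => ?_) (fun K hK => ?_) hH
    · exact (hl _).trans (chowLift_chowVar _ _ hK)
    · exact (hr _).trans (chowLift_chowVar _ _ hK)
  have h1 : g a = 0 := by
    rw [← hθ, AlgHom.comp_apply, ha, map_zero]
  exact (hI _).1 (Ideal.Quotient.eq_zero_iff_mem.1 h1)

end IsCenter

end

/-! ### Presentation of the blown-up ring and the Hilbert series. -/

section

universe u

lemma hilb_eq_degSeries {α ι : Type*} {M : Matroid α} {𝒢 : Set (Set α)}
    {b : Module.Basis ι ℚ (ChowRing M 𝒢)} {d : ι → ℕ} (h : IsGradedBasis (chowPiece M 𝒢) b d) :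
    hilb M 𝒢 = degSeries d := by
  ext n
  rw [hilb, degSeries, PowerSeries.coeff_mk, PowerSeries.coeff_mk, h.finrank_eq]

lemma degSeries_equiv {ι κ : Type*} (e : ι ≃ κ) (d : κ → ℕ) :
    degSeries (fun i => d (e i)) = degSeries d := by
  ext n
  rw [degSeries, degSeries, PowerSeries.coeff_mk, PowerSeries.coeff_mk]
  exact congrArg _ (Nat.card_congr (e.subtypeEquiv fun _ => Iff.rfl))

lemma IsExc.congr {α R : Type*} [CommRing R] {M : Matroid α} {𝒢 : Set (Set α)} {G : Set α}
    {x y : Set α → R} {t : R} (hx : IsExc M 𝒢 G x t) (h : ∀ H ∈ 𝒢, x H = y H) :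
    IsExc M 𝒢 G y t := by
  intro K hK hGK S hS
  rw [← ups_congr fun H hH _ => h H hH, ← Finset.prod_congr rfl fun H hH => h H (hS H hH).1]
  exact hx K hK hGK S hS

lemma neg_one_card_mul_prod {ι R : Type*} [CommRing R] (S : Finset ι) (f : ι → R) :
    (-1) ^ S.card * ∏ i ∈ S, f i = ∏ i ∈ S, -f i :=
  Finset.prod_neg _ |>.symm

open Polynomial in
/-- The quotient of `A[t]` by the ideal generated by `P` and by `t` times the kernel of `ψ`. -/
lemma exists_quotient {A D : Type u} [CommRing A] [CommRing D] [Algebra ℚ A] (ψ : A →+* D)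
    (P : A[X]) : ∃ (R : Type u) (_ : CommRing R) (_ : Algebra ℚ R) (π : A[X] →ₐ[ℚ] R),
      π P = 0 ∧ (∀ a, ψ a = 0 → π X * π (C a) = 0) ∧
        ∀ q, π q = 0 → ∃ f g : A[X], g.map ψ = 0 ∧ q = P * f + X * g := by
  let I : Ideal A[X] := Ideal.span {P} ⊔ Ideal.span {X} * RingHom.ker (mapRingHom ψ)
  refine ⟨A[X] ⧸ I, inferInstance, inferInstance, Ideal.Quotient.mkₐ ℚ I, ?_, fun a ha => ?_,
    fun q hq => ?_⟩
  · exact Ideal.Quotient.eq_zero_iff_mem.2 (Ideal.mem_sup_left (Ideal.mem_span_singleton_self _))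
  · rw [← map_mul]
    refine Ideal.Quotient.eq_zero_iff_mem.2 (Ideal.mem_sup_right
      (Ideal.mul_mem_mul (Ideal.mem_span_singleton_self X) ?_))
    rw [RingHom.mem_ker, coe_mapRingHom, map_C, ha, C_0]
  · obtain ⟨f, y, hy, rfl⟩ :=
      Ideal.mem_span_singleton_sup.1 (Ideal.Quotient.eq_zero_iff_mem.1 hq)
    obtain ⟨g, hg, rfl⟩ := Ideal.mem_span_singleton_mul.1 hy
    exact ⟨f, g, hg, by rw [mul_comm f]⟩

namespace IsCenter

open Polynomial

variable {α : Type u} {M : Matroid α} {𝒢 : Set (Set α)} {G : Set α}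

lemma ncard_factors_pos (h : IsCenter M 𝒢 G) (hG : G.Nonempty) :
    0 < (factors (restr 𝒢 G)).ncard := by
  rw [Set.ncard_pos h.finite_factors]
  rw [← h.sUnion_factors] at hG
  obtain ⟨e, L, hL, -⟩ := hG
  exact ⟨L, hL⟩

lemma mem_of_mem_factors (h : IsCenter M 𝒢 G) {L : Set α}
    (hL : L ∈ h.finite_factors.toFinset) : L ∈ 𝒢 := by
  rw [Set.Finite.mem_toFinset] at hL
  exact hL.1.1

/-- The polynomial whose value at the exceptional variable vanishes. -/
def excPoly (h : IsCenter M 𝒢 G) : (ChowRing M 𝒢)[X] :=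
  ∏ L ∈ h.finite_factors.toFinset, (X - C (chowVar M 𝒢 L))

lemma natDegree_excPoly (h : IsCenter M 𝒢 G) [Nontrivial (ChowRing M 𝒢)] :
    h.excPoly.natDegree = (factors (restr 𝒢 G)).ncard := by
  rw [excPoly, natDegree_finsetProd_X_sub_C_eq_card, Set.ncard_eq_toFinset_card _ h.finite_factors]

lemma coeff_zero_excPoly (h : IsCenter M 𝒢 G) : h.excPoly.coeff 0 =
    (-1) ^ h.finite_factors.toFinset.card * h.factorProd (chowVar M 𝒢) := by
  rw [excPoly, coeff_zero_eq_eval_zero, eval_prod, factorProd, neg_one_card_mul_prod]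
  simp

lemma eval₂_excPoly {R : Type*} [CommRing R] (h : IsCenter M 𝒢 G) (f : ChowRing M 𝒢 →+* R)
    (t : R) : h.excPoly.eval₂ f t = (-1) ^ h.finite_factors.toFinset.card *
      ∏ L ∈ h.finite_factors.toFinset, (f (chowVar M 𝒢 L) - t) := by
  rw [excPoly, eval₂_finsetProd, neg_one_card_mul_prod]
  simp

variable [M.Finite]

/-- The pullback along the blow-up. -/
def pullbackHom (h : IsCenter M 𝒢 G) : ChowRing M 𝒢 →ₐ[ℚ] ChowRing M (insert G 𝒢) :=
  chowLift h.finite (h.isChow_pullback (isChow_chowVar (h.finite.insert G)))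

lemma pullbackHom_chowVar (h : IsCenter M 𝒢 G) {H : Set α} (hH : H ∈ 𝒢) :
    h.pullbackHom (chowVar M 𝒢 H) = h.pullback (chowVar M (insert G 𝒢)) H :=
  chowLift_chowVar _ _ hH

lemma isExc_pullbackHom (h : IsCenter M 𝒢 G) :
    IsExc M 𝒢 G (fun H => h.pullbackHom (chowVar M 𝒢 H)) (chowVar M (insert G 𝒢) G) :=
  (h.isExc_pullback (isChow_chowVar (h.finite.insert G))).congr fun _ hH =>
    (h.pullbackHom_chowVar hH).symm

lemma eval₂_excPoly_pullbackHom (h : IsCenter M 𝒢 G) :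
    h.excPoly.eval₂ (h.pullbackHom : _ →+* _) (chowVar M (insert G 𝒢) G) = 0 := by
  rw [eval₂_excPoly, ← mul_zero ((-1) ^ h.finite_factors.toFinset.card),
    ← h.factorProd_pullback_sub (isChow_chowVar (M := M) (h.finite.insert G))]
  congr 1
  refine Finset.prod_congr rfl fun L hL => ?_
  rw [← h.pullbackHom_chowVar (h.mem_of_mem_factors hL), RingHom.coe_coe]

lemma exists_eval₂_eq (h : IsCenter M 𝒢 G) (b : ChowRing M (insert G 𝒢)) :
    ∃ q : (ChowRing M 𝒢)[X],
      q.eval₂ (h.pullbackHom : _ →+* _) (chowVar M (insert G 𝒢) G) = b := by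
  let Φ := eval₂AlgHom h.pullbackHom (chowVar M (insert G 𝒢) G) fun _ => Commute.all _ _
  suffices b ∈ Φ.range from this
  have hG : chowVar M (insert G 𝒢) G ∈ Φ.range := ⟨X, by simp [Φ]⟩
  refine chowRing_map_mem Φ.range (AlgHom.id ℚ _) (fun H hH => ?_) b
  rcases hH with rfl | hH
  · exact hG
  · have h1 : h.pullback (chowVar M (insert G 𝒢)) H ∈ Φ.range :=
      ⟨C (chowVar M 𝒢 H), by simp [Φ, h.pullbackHom_chowVar hH]⟩
    by_cases hf : H ∈ factors (restr 𝒢 G)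
    · rw [h.pullback_of_mem _ hf] at h1
      have := sub_mem h1 hG
      rwa [add_sub_cancel_right] at this
    · rwa [h.pullback_of_notMem _ hf] at h1

variable {D : Type u} [CommRing D] [Algebra ℚ D] {l : ChowRing (M ↾ G) (restr 𝒢 G) →ₐ[ℚ] D}
  {r : ChowRing (M ／ G) (contr M 𝒢 G) →ₐ[ℚ] D}

/-- The kernel of the evaluation at the exceptional variable. -/
lemma exists_of_eval₂_eq_zero (h : IsCenter M 𝒢 G) {q : (ChowRing M 𝒢)[X]}
    (hq : q.eval₂ (h.pullbackHom : _ →+* _) (chowVar M (insert G 𝒢) G) = 0) :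
    ∃ f g : (ChowRing M 𝒢)[X], g.map (h.toCenterHom l r : ChowRing M 𝒢 →+* D) = 0 ∧
      q = h.excPoly * f + X * g := by
  -- `R` is the expected presentation, with exceptional class `π X`. The strict variables define a
  -- map `Ω` into `R` whose composite with evaluation is `π`, so the kernel of evaluation lies in
  -- that of `π`.
  obtain ⟨R, _, _, π, hπP, hπX, hπ⟩ :=
    exists_quotient (h.toCenterHom l r : ChowRing M 𝒢 →+* D) h.excPoly
  let x : Set α → R := fun H => π (C (chowVar M 𝒢 H))
  have hx : IsChow M 𝒢 x :=
    (isChow_chowVar h.finite).map h.finite ((π : (ChowRing M 𝒢)[X] →+* R).comp C)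
  have ht : IsExc M 𝒢 G x (π X) := by
    intro K hK hGK S hS
    have h1 := (h.isExc_toCenter (z := fun H => l (chowVar _ _ H)) (h.isChow_contr r)).congr
      (fun H hH => (h.toCenterHom_chowVar hH).symm) K hK hGK S hS
    rw [one_mul] at h1
    have h2 := hπX ((∏ H ∈ S, chowVar M 𝒢 H) *
      ups 𝒢 (chowVar M 𝒢) K ^ (rk M K - rk M (⋃₀ ↑S ∪ G))) (by
        rw [map_mul, map_prod, map_pow, map_ups h.finite]; exact h1)
    rw [C_mul, C_pow, map_mul, map_prod, map_pow, ← mul_assoc, map_prod] at h2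
    have h3 := map_ups h.finite ((π : (ChowRing M 𝒢)[X] →+* R).comp C) (chowVar M 𝒢) K
    rw [RingHom.comp_apply, RingHom.coe_coe] at h3
    rw [h3] at h2
    exact h2
  have hP : ∏ L ∈ h.finite_factors.toFinset, (x L - π X) = 0 := by
    have h1 := h.eval₂_excPoly ((π : (ChowRing M 𝒢)[X] →+* R).comp C) (π X)
    have h2 := hom_eval₂ h.excPoly C (π : (ChowRing M 𝒢)[X] →+* R) X
    rw [eval₂_C_X, RingHom.coe_coe, hπP] at h2
    exact ((isUnit_one.neg.pow _).mul_right_eq_zero).1 (h2.trans h1).symm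
  let Φ := eval₂AlgHom h.pullbackHom (chowVar M (insert G 𝒢) G) fun _ => Commute.all _ _
  let Ω : ChowRing M (insert G 𝒢) →ₐ[ℚ] R :=
    chowLift (h.finite.insert G) (h.isChow_strict hx ht hP)
  have hΩ : ∀ H ∈ insert G 𝒢, Ω (chowVar M _ H) = h.strict x (π X) H :=
    fun H hH => chowLift_chowVar _ _ hH
  have hG : Ω (chowVar M _ G) = π X := by
    rw [hΩ G (Or.inl rfl), h.strict_center]
  have hcomp : Ω.comp Φ = π := by
    refine algHom_ext' (chowRing_hom_ext fun H hH => ?_) ?_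
    · change Ω (Φ (C (chowVar M 𝒢 H))) = π (C (chowVar M 𝒢 H))
      have h1 : Φ (C (chowVar M 𝒢 H)) = h.pullback (chowVar M (insert G 𝒢)) H := by
        simp [Φ, h.pullbackHom_chowVar hH]
      rw [h1]
      by_cases hf : H ∈ factors (restr 𝒢 G)
      · rw [h.pullback_of_mem _ hf, map_add, hG, hΩ H (Or.inr hH), h.strict_of_mem hH, if_pos hf,
          sub_add_cancel]
      · rw [h.pullback_of_notMem _ hf, hΩ H (Or.inr hH), h.strict_of_mem hH, if_neg hf, sub_zero]
    · have h1 : Φ X = chowVar M (insert G 𝒢) G := by simp [Φ]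
      rw [AlgHom.comp_apply, h1, hG]
  refine hπ q ?_
  rw [← hcomp, AlgHom.comp_apply]
  change Ω (q.eval₂ (h.pullbackHom : _ →+* _) (chowVar M (insert G 𝒢) G)) = 0
  rw [hq, map_zero]

lemma pullbackHom_mem (h : IsCenter M 𝒢 G) {n : ℕ} {a : ChowRing M 𝒢}
    (ha : a ∈ chowPiece M 𝒢 n) : h.pullbackHom a ∈ chowPiece M (insert G 𝒢) n := by
  refine map_chowPiece_le (chowPiece M (insert G 𝒢)) h.pullbackHom (fun H hH => ?_) n ⟨a, ha, rfl⟩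
  rw [h.pullbackHom_chowVar hH]
  by_cases hf : H ∈ factors (restr 𝒢 G)
  · rw [h.pullback_of_mem _ hf]
    exact Submodule.add_mem _ (chowVar_mem H) (chowVar_mem G)
  · rw [h.pullback_of_notMem _ hf]
    exact chowVar_mem H

/-- Surjectivity in each single degree is what lets a basis of the coproduct lift to homogeneous
elements. -/
lemma map_chowPiece_toCenterHom (h : IsCenter M 𝒢 G) (hC : IsCoproduct l r)
    {N : ℕ → Submodule ℚ D} [SetLike.GradedMonoid N] (hN : iSupIndep N)
    (hl : ∀ x ∈ chowPiece (M ↾ G) (restr 𝒢 G) 1, l x ∈ N 1)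
    (hr : ∀ x ∈ chowPiece (M ／ G) (contr M 𝒢 G) 1, r x ∈ N 1) (n : ℕ) :
    (chowPiece M 𝒢 n).map (h.toCenterHom l r).toLinearMap = N n := by
  refine congrFun (eq_of_le_of_iSup_eq_top
    (map_chowPiece_le N (h.toCenterHom l r) fun H hH => ?_) hN ?_) n
  · rw [h.toCenterHom_chowVar hH]
    exact h.toCenter_mem _ (fun H => hl _ (chowVar_mem H)) (fun X => hr _ (chowVar_mem X)) H
  · rw [← Submodule.map_iSup, iSup_chowPiece, Submodule.map_top, LinearMap.range_eq_top]
    exact h.toCenterHom_surjective hC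

lemma blowUpMap_bijective (h : IsCenter M 𝒢 G) (hC : IsCoproduct l r) {s : D →ₗ[ℚ] ChowRing M 𝒢}
    (hs : ∀ c, h.toCenterHom l r (s c) = c) {m : ℕ}
    (hm : (factors (restr 𝒢 G)).ncard = m + 1) :
    Function.Bijective (blowUpMap h.pullbackHom (chowVar M (insert G 𝒢) G) s m) := by
  -- The degree of `excPoly` needs a nontrivial ring; over the zero ring everything collapses.
  rcases subsingleton_or_nontrivial (ChowRing M 𝒢) with hA | hA
  · have : Subsingleton D := (h.toCenterHom_surjective hC).subsingleton
    have : Subsingleton (ChowRing M (insert G 𝒢)) := by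
      refine subsingleton_of_zero_eq_one ?_
      rw [← map_zero h.pullbackHom, ← map_one h.pullbackHom, Subsingleton.elim (0 : ChowRing M 𝒢) 1]
    exact ⟨fun _ _ _ => Subsingleton.elim _ _, fun b => ⟨0, Subsingleton.elim _ _⟩⟩
  have hP : h.excPoly.Monic := monic_prod_X_sub_C _ _
  have hd : h.excPoly.natDegree = m + 1 := h.natDegree_excPoly.trans hm
  refine ⟨blowUpMap_injective hs hP hd (fun a ha => ?_) fun q => h.exists_of_eval₂_eq_zero,
    blowUpMap_surjective hs hP hd h.eval₂_excPoly_pullbackHom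
      (fun a => h.mul_eq_zero_of_toCenterHom_eq_zero hC _ h.isExc_pullbackHom) h.exists_eval₂_eq⟩
  -- Up to sign `P(0)` is the product of the factor variables, which is exceptional in the Chow ring
  -- of `𝒢` itself.
  rw [h.coeff_zero_excPoly, mul_assoc]
  refine mul_eq_zero_of_right _ ?_
  exact h.mul_eq_zero_of_toCenterHom_eq_zero hC (AlgHom.id ℚ _)
    (h.isExc_factorProd (isChow_chowVar h.finite)) ha

theorem hilb_insert (h : IsCenter M 𝒢 G) (hG : G.Nonempty) :
    hilb M (insert G 𝒢) = hilb M 𝒢 +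
      (∑ i ∈ Finset.Ico 1 (factors (restr 𝒢 G)).ncard, (PowerSeries.X : ℤ⟦X⟧) ^ i) *
        hilb (M ↾ G) (restr 𝒢 G) * hilb (M ／ G) (contr M 𝒢 G) := by
  obtain ⟨ι, b, d, hb⟩ := exists_isGradedBasis (iSupIndep_chowPiece (M := M) (𝒢 := 𝒢))
    iSup_chowPiece
  obtain ⟨ι₁, b₁, d₁, hb₁⟩ := exists_isGradedBasis
    (iSupIndep_chowPiece (M := M ↾ G) (𝒢 := restr 𝒢 G)) iSup_chowPiece
  obtain ⟨ι₂, b₂, d₂, hb₂⟩ := exists_isGradedBasis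
    (iSupIndep_chowPiece (M := M ／ G) (𝒢 := contr M 𝒢 G)) iSup_chowPiece
  obtain ⟨D, _, _, l, r, N, v, hC, _, hv, hN, hl, hr⟩ := exists_isCoproduct hb₁ hb₂
  have hf : ∀ n, Finite {i // d i = n} := fun n =>
    have := finite_chowPiece (M := M) h.finite n; hb.finite n
  have hf₁ : ∀ n, Finite {i // d₁ i = n} := fun n =>
    have := finite_chowPiece (M := M ↾ G) (finite_restr h.finite G) n; hb₁.finite n
  have hf₂ : ∀ n, Finite {i // d₂ i = n} := fun n =>
    have := finite_chowPiece (M := M ／ G) h.finite_contr n; hb₂.finite n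
  obtain ⟨m, hm⟩ := Nat.exists_eq_succ_of_ne_zero (h.ncard_factors_pos hG).ne'
  have hlift : ∀ p, ∃ a ∈ chowPiece M 𝒢 (d₁ p.1 + d₂ p.2), h.toCenterHom l r a = v p := by
    intro p
    have := hv.mem p
    rw [← h.map_chowPiece_toCenterHom hC hN hl hr] at this
    exact this
  choose s₀ hs₀ hs₁ using hlift
  -- A degree-preserving section of restriction to the center; linearity suffices.
  let s : D →ₗ[ℚ] ChowRing M 𝒢 := v.constr ℚ s₀
  have hsv : ∀ p, s (v p) = s₀ p := fun p => v.constr_basis ℚ s₀ p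
  have hs : ∀ c, h.toCenterHom l r (s c) = c := by
    have : (h.toCenterHom l r).toLinearMap ∘ₗ s = LinearMap.id := v.ext fun p => by
      rw [LinearMap.comp_apply, hsv]; exact hs₁ p
    exact fun c => LinearMap.congr_fun this c
  let Θ := LinearEquiv.ofBijective _ (h.blowUpMap_bijective hC hs hm)
  have hΘ : ∀ a c, Θ (a, c) = h.pullbackHom a +
      ∑ j : Fin m, chowVar M (insert G 𝒢) G ^ (j + 1 : ℕ) * h.pullbackHom (s (c j)) :=
    fun a c => blowUpMap_apply _ _ _ _ a c
  let bB := (b.prod (Pi.basis fun _ : Fin m => v)).map Θ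
  -- The copy of `C` indexed by `j : Fin m` is multiplied by `t ^ (j + 1)`, whence the shift in
  -- degree.
  let dB : ι ⊕ (Σ _ : Fin m, ι₁ × ι₂) → ℕ :=
    Sum.elim d fun q => ((q.1 : ℕ) + 1) + (d₁ q.2.1 + d₂ q.2.2)
  have hbB : IsGradedBasis (chowPiece M (insert G 𝒢)) bB dB := by
    refine isGradedBasis_of_mem iSupIndep_chowPiece bB dB ?_
    rintro (i | ⟨j, p⟩)
    · have : bB (Sum.inl i) = h.pullbackHom (b i) := by
        simp [bB, hΘ]
      rw [this]
      exact h.pullbackHom_mem (hb.mem i)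
    · have : bB (Sum.inr ⟨j, p⟩) =
          chowVar M (insert G 𝒢) G ^ (j + 1 : ℕ) * h.pullbackHom (s₀ p) := by
        simp only [bB, Module.Basis.map_apply, Module.Basis.prod_apply, Sum.elim_inr,
          Function.comp_apply, LinearMap.inr_apply, hΘ,
          Pi.basis_apply, map_zero, zero_add]
        rw [Finset.sum_eq_single j]
        · rw [Pi.single_eq_same, hsv]
        · intro i _ hij
          rw [Pi.single_eq_of_ne hij, map_zero, map_zero, mul_zero]
        · simp
      rw [this]
      have h1 := SetLike.pow_mem_graded (A := chowPiece M (insert G 𝒢)) (j + 1 : ℕ)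
        (chowVar_mem G)
      rw [smul_eq_mul, mul_one] at h1
      exact SetLike.mul_mem_graded h1 (h.pullbackHom_mem (hs₀ p))
  have hfin : ∀ n, Finite {j : Fin m // (j : ℕ) + 1 = n} := fun n => inferInstance
  have hf₃ := finite_degProd d₁ d₂ hf₁ hf₂
  have hf₄ := finite_degProd (fun j : Fin m => (j : ℕ) + 1) _ hfin hf₃
  have he := degSeries_equiv (Equiv.sigmaEquivProd (Fin m) (ι₁ × ι₂))
    fun q => ((q.1 : ℕ) + 1) + (d₁ q.2.1 + d₂ q.2.2)
  rw [hilb_eq_degSeries hbB, hilb_eq_degSeries hb, hilb_eq_degSeries hb₁, hilb_eq_degSeries hb₂,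
    degSeries_sum d (fun q : Σ _ : Fin m, ι₁ × ι₂ =>
      ((q.1 : ℕ) + 1) + (d₁ q.2.1 + d₂ q.2.2)) hf fun n => Finite.of_equiv _
      ((Equiv.sigmaEquivProd (Fin m) (ι₁ × ι₂)).subtypeEquiv fun _ => Iff.rfl).symm (h := hf₄ n)]
  congr 1
  rw [hm, ← degSeries_fin, mul_assoc, ← degSeries_prod d₁ d₂ hf₁ hf₂,
    ← degSeries_prod (fun j : Fin m => (j : ℕ) + 1) _ hfin hf₃]
  exact he

end IsCenter

end

end BuildingSet

end

theorem theorem5p1 {α : Type*} (M : Matroid α) [M.Finite] [M.Loopless]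
    (𝒢 𝒢' : Set (Set α)) (G : Set α) (hG : G ∈ 𝒢) (h𝒢' : 𝒢' = 𝒢 \ {G})
    (hB : BuildingSet.IsBuildingSet M 𝒢) (hB' : BuildingSet.IsBuildingSet M 𝒢') :
    BuildingSet.hilb M 𝒢 = BuildingSet.hilb M 𝒢' +
      (∑ i ∈ Finset.Ico 1 (BuildingSet.factors (BuildingSet.restr 𝒢' G)).ncard,
          (PowerSeries.X : ℤ⟦X⟧) ^ i) *
        BuildingSet.hilb (M ↾ G) (BuildingSet.restr 𝒢' G) *
        BuildingSet.hilb (M ／ G) (BuildingSet.contr M 𝒢' G) := by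
  have h := BuildingSet.IsBuildingSet.isCenter hG h𝒢' hB hB'
  have h1 : insert G 𝒢' = 𝒢 := by rw [h𝒢', Set.insert_sdiff_singleton, Set.insert_eq_of_mem hG]
  rw [← h.hilb_insert (hB.nonempty G hG), h1]
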